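/- **Setting.** Let $n_1,\dots,n_K\ge 2$ be integers, $n=\sum_k n_k$, and let $\nu_1,\dots,\nu_K>2$ be real. For $\nu>2$ let $t^{\mathrm{std}}_\nu(0,I_m)$ be the distribution on $\mathbb R^m$ with density $\frac{\Gamma((\nu+m)/2)}{\Gamma(\nu/2)}[(\nu-2)\pi]^{-m/2}\bigl(1+\tfrac{x'x}{\nu-2}\bigr)^{-(\nu+m)/2}$, and for a nonsingular $n\times n$ matrix $M$ let $\mathrm{CT}^{\mathrm{std}}_{\boldsymbol n,\boldsymbol\nu}(0,M)$ be the law of $M(V_1',\dots,V_K')'$ with independent $V_k\sim t^{\mathrm{std}}_{\nu_k}(0,I_{n_k})$. Let $C$ be a positive definite block correlation matrix: it has unit diagonal, all entries of its $(k,l)$ block, $k\ne l$, equal $\rho_{kl}$, and all off-diagonal entries of its $k$-th diagonal block equal $\rho_{kk}$. Let $A\in\mathbb R^{K\times K}$ have entries $A_{kk}=1+(n_k-1)\rho_{kk}$ and $A_{kl}=\rho_{kl}\sqrt{n_kn_l}$ for $k\neq l$, and let $\lambda_k=\frac{n_k-A_{kk}}{n_k-1}$. Let $v_{n_k}=(1/\sqrt{n_k},\dots,1/\sqrt{n_k})'\in\mathbb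 R^{n_k}$, let $v_{n_k}^\perp\in\mathbb R^{n_k\times(n_k-1)}$ be any matrix with orthonormal columns orthogonal to $v_{n_k}$, and let $Q=\bigl(\mathrm{diag}(v_{n_1},\dots,v_{n_K}),\ \mathrm{diag}(v_{n_1}^\perp,\dots,v_{n_K}^\perp)\bigr)$ (block diagonal), so that $C=QDQ'$ with $D=\mathrm{diag}(A,\lambda_1I_{n_1-1},\dots,\lambda_KI_{n_K-1})$. For a square matrix $B$, $B^{1/2}$ is the principal square root (the square root whose eigenvalues all have positive real part; for a symmetric positive definite matrix this is the symmetric positive definite one), and $B^{-1/2}=(B^{1/2})^{-1}$. For all $K\times K$ matrices $B$ in a neighbourhood of $A$, let $\ell(B;z)$ be the logarithm of the density at $z\in\mathbb R^n$ of $\mathrm{CT}^{\mathrm{std}}_{\boldsymbol n,\boldsymbol\nu}(0,C(B)^{1/2})$, where $C(B)$ is obtained from $QDQ'$ by replacing $A$ by $B$, also in the $\lambda_k$. Suppose $Z\sim \mathrm{CT}^{\mathrm{std}}_{\boldsymbol n,\boldsymbol\nu}(0,C^{1/2})$, and let $\nabla_A=\partial \ell(A;Z)/\partial\mathrm{vec}(A)$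 (the gradient with respect to all $K^2$ entries) and $\mathcal I_A=\mathbb E[\nabla_A\nabla_A']$. **Notation.** $G\oplus H=G\otimes H+H\otimes G$; $e_k$ is the $k$-th column of $I_K$; $J_k=e_ke_k'$; $K_K$ is the commutation matrix, $K_K\mathrm{vec}(B)=\mathrm{vec}(B')$; $E_d$ is the $K\times K^2$ matrix with $E_d\mathrm{vec}(B)=(B_{11},\dots,B_{KK})'$. Let $X=(X_0',X_1',\dots,X_K')'=Q'C^{-1/2}Z$ with $X_0\in\mathbb R^K$ and $X_k\in\mathbb R^{n_k-1}$, and $$W_k=\frac{\nu_k+n_k}{\nu_k-2+X_{0,k}^2+X_k'X_k},\qquad \phi_k=\frac{\nu_k+n_k}{\nu_k+n_k+2},\qquad \psi_k=\phi_k\frac{\nu_k}{\nu_k-2}.$$ **Theorem.** For every value $z\in\mathbb R^n$ of $Z$ the log-likelihood $B\mapsto\ell(B;z)$ is differentiable at $A$, and $$\nabla_A=\Omega_A\Bigl[\sum_{k=1}^K W_kX_{0,k}\,\mathrm{vec}(e_kX_0')-\mathrm{vec}(I_K)\Bigr]+\tfrac12E_d'S .$$ The entries of $\nabla_A\nabla_A'$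 are integrable, and $$\mathcal I_A=\Omega_A(K_K+\Upsilon_K)\Omega_A+\tfrac14E_d'\,\Xi\,E_d+\tfrac12E_d'\,\Theta\,\Omega_A+\tfrac12\,\Omega_A\Theta'E_d .$$ Here $\Omega_A=(I_K\otimes A^{-1/2})(A^{1/2}\oplus I_K)^{-1}$; $S\in\mathbb R^K$ has entries $S_k=\frac1{\lambda_k}-\frac{W_kX_k'X_k}{\lambda_k(n_k-1)}$; $\Xi$ is the diagonal $K\times K$ matrix with $\Xi_{kk}=\frac{\phi_k-1}{\lambda_k^2}+\frac{2\phi_k}{\lambda_k^2(n_k-1)}$; $\Theta=\sum_{k=1}^K\lambda_k^{-1}(1-\phi_k)\,e_k\mathrm{vec}(J_k)'$; and $\Upsilon_K=\sum_{k=1}^K\Psi_k$ with $$\Psi_k=\psi_k(I_K\otimes J_k)+(\phi_k-\psi_k)(J_k\otimes J_k)+(\phi_k-1)\bigl[(J_k\otimes J_k)K_K+\mathrm{vec}(J_k)\mathrm{vec}(J_k)'\bigr].$$ -/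

import Mathlib

open MeasureTheory ProbabilityTheory Matrix
open scoped Kronecker

noncomputable section

namespace ClusterT

/-! ### Matrix notation -/

/-- `S` is a principal square root of the real square matrix `B`: `S * S = B` and every complex
eigenvalue of `S` has positive real part. At most one such `S` exists; if `B` is symmetric positive
definite, it is the symmetric positive definite square root of `B`. -/
def IsPrincipalSqrt {m : Type*} [Fintype m] [DecidableEq m] (S B : Matrix m m ℝ) : Prop :=
  S * S = B ∧ ∀ μ ∈ spectrum ℂ (S.map (fun x : ℝ => (x : ℂ))), 0 < μ.re

open Classical in
/-- The matrix `B^{1/2}`: the principal square root of `B` (zero if `B` has none). It is defined on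
a neighbourhood, in the space of all square matrices, of every symmetric positive definite
matrix. -/
def principalSqrt {m : Type*} [Fintype m] [DecidableEq m] (B : Matrix m m ℝ) : Matrix m m ℝ :=
  if h : ∃ S : Matrix m m ℝ, IsPrincipalSqrt S B then h.choose else 0

/-- `A ⊕ B = A ⊗ B + B ⊗ A`. -/
def kronSum {m : Type*} (A B : Matrix m m ℝ) : Matrix (m × m) (m × m) ℝ :=
  A ⊗ₖ B + B ⊗ₖ A

/-- The commutation matrix, `commMat m *ᵥ vec B = vec Bᵀ`. -/
def commMat (m : Type*) [DecidableEq m] : Matrix (m × m) (m × m) ℝ :=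
  Matrix.of fun p q => if p = q.swap then 1 else 0

/-- The elimination matrix of the diagonal, `diagElim m *ᵥ vec B = diag B`. -/
def diagElim (m : Type*) [DecidableEq m] : Matrix m (m × m) ℝ :=
  Matrix.of fun k p => if p = (k, k) then 1 else 0

/-- The inverse of `Matrix.vec`, from `ℝ^{m²}` to matrices. -/
def unvec {m : Type*} (a : EuclideanSpace ℝ (m × m)) : Matrix m m ℝ :=
  Matrix.of fun i j => a (j, i)

/-- `J_k = e_k e_k'`. -/
def unitJ {m : Type*} [DecidableEq m] (k : m) : Matrix m m ℝ :=
  vecMulVec (Pi.single k 1) (Pi.single k 1)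

/-! ### Block correlation matrices and their canonical form

The `n = ∑ k, n k` variables are indexed by `Σ k, Fin (n k)` (cluster, position in the cluster); the
canonical variables by `Fin K ⊕ Σ k, Fin (n k - 1)`. -/

variable {K : ℕ}

/-- The block correlation matrix with cluster sizes `n` and block correlations `ρ`. -/
def blockCorr (n : Fin K → ℕ) (ρ : Matrix (Fin K) (Fin K) ℝ) :
    Matrix (Σ k, Fin (n k)) (Σ k, Fin (n k)) ℝ :=
  Matrix.of fun i j => if i = j then 1 else ρ i.1 j.1

/-- The upper left block `A` of the canonical representation. -/
def canonA (n : Fin K → ℕ) (ρ : Matrix (Fin K) (Fin K) ℝ) : Matrix (Fin K) (Fin K) ℝ :=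
  Matrix.of fun k l =>
    if k = l then 1 + ((n k : ℝ) - 1) * ρ k k else ρ k l * √((n k : ℝ) * (n l : ℝ))

/-- `λ_k = (n_k - A_kk) / (n_k - 1)`. -/
def lam (n : Fin K → ℕ) (A : Matrix (Fin K) (Fin K) ℝ) (k : Fin K) : ℝ :=
  ((n k : ℝ) - A k k) / ((n k : ℝ) - 1)

/-- `D = diag(A, λ_1 I_{n_1 - 1}, …, λ_K I_{n_K - 1})`. -/
def canonD (n : Fin K → ℕ) (A : Matrix (Fin K) (Fin K) ℝ) :
    Matrix (Fin K ⊕ Σ k, Fin (n k - 1)) (Fin K ⊕ Σ k, Fin (n k - 1)) ℝ :=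
  Matrix.fromBlocks A 0 0 (Matrix.diagonal fun i => lam n A i.1)

/-- `v_{n_k} = (1/√n_k, …, 1/√n_k)'`. -/
def unitVec (m : ℕ) : Fin m → ℝ := fun _ => 1 / √(m : ℝ)

/-- `vp` is an admissible choice of the matrices `v_{n_k}^⊥`: orthonormal columns, all orthogonal to
`v_{n_k}`. -/
def IsOrthoComplement (n : Fin K → ℕ) (vp : ∀ k, Matrix (Fin (n k)) (Fin (n k - 1)) ℝ) : Prop :=
  ∀ k, (vp k)ᵀ * vp k = 1 ∧ unitVec (n k) ᵥ* vp k = 0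

/-- The orthonormal matrix `Q`, whose columns are the `v_{n_k}` followed by the `v_{n_k}^⊥`, each
supported on its own cluster. -/
def canonQ (n : Fin K → ℕ) (vp : ∀ k, Matrix (Fin (n k)) (Fin (n k - 1)) ℝ) :
    Matrix (Σ k, Fin (n k)) (Fin K ⊕ Σ k, Fin (n k - 1)) ℝ :=
  Matrix.fromCols (Matrix.of fun i k => if i.1 = k then unitVec (n i.1) i.2 else 0)
    (Matrix.blockDiagonal' vp)

/-- `C(A) = Q D Q'`, the matrix with canonical block `A`. -/
def canonC (n : Fin K → ℕ) (vp : ∀ k, Matrix (Fin (n k)) (Fin (n k - 1)) ℝ)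
    (A : Matrix (Fin K) (Fin K) ℝ) : Matrix (Σ k, Fin (n k)) (Σ k, Fin (n k)) ℝ :=
  canonQ n vp * canonD n A * (canonQ n vp)ᵀ

/-! ### Distributions -/

/-- The density of the standardized multivariate `t`-distribution `t_ν^std(0, I_m)`, `ν > 2`. -/
def stdTDensity (ν : ℝ) (m : ℕ) (x : Fin m → ℝ) : ℝ :=
  Real.Gamma ((ν + m) / 2) / Real.Gamma (ν / 2) * ((ν - 2) * Real.pi) ^ (-(m : ℝ) / 2) *
    (1 + (x ⬝ᵥ x) / (ν - 2)) ^ (-(ν + m) / 2)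

/-- The distribution `t_ν^std(0, I_m)`. -/
def stdT (ν : ℝ) (m : ℕ) : Measure (Fin m → ℝ) :=
  volume.withDensity fun x => ENNReal.ofReal (stdTDensity ν m x)

/-- The convolution-`t` distribution `CT_{n,ν}^std(0, M)`: the law of `M V`, where
`V = (V_1', …, V_K')'` with independent `V_k ∼ t_{ν_k}^std(0, I_{n_k})`. -/
def ctLaw (n : Fin K → ℕ) (ν : Fin K → ℝ) (M : Matrix (Σ k, Fin (n k)) (Σ k, Fin (n k)) ℝ) :
    Measure ((Σ k, Fin (n k)) → ℝ) :=
  (Measure.pi fun k => stdT (ν k) (n k)).map fun v => M *ᵥ fun i => v i.1 i.2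

/-- The density of `CT_{n,ν}^std(0, M)` for nonsingular `M`. -/
def ctDensity (n : Fin K → ℕ) (ν : Fin K → ℝ) (M : Matrix (Σ k, Fin (n k)) (Σ k, Fin (n k)) ℝ)
    (z : (Σ k, Fin (n k)) → ℝ) : ℝ :=
  |M.det|⁻¹ * ∏ k, stdTDensity (ν k) (n k) fun i => (M⁻¹ *ᵥ z) ⟨k, i⟩

/-- The log-likelihood, at the observation `z`, of the model `CT_{n,ν}^std(0, C^{1/2})` with
`C = C(A)`, as a function of `vec A`. -/
def logLik (n : Fin K → ℕ) (ν : Fin K → ℝ) (vp : ∀ k, Matrix (Fin (n k)) (Fin (n k - 1)) ℝ)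
    (z : (Σ k, Fin (n k)) → ℝ) (a : EuclideanSpace ℝ (Fin K × Fin K)) : ℝ :=
  Real.log (ctDensity n ν (principalSqrt (canonC n vp (unvec a))) z)

/-- The score `∇_A = ∂ℓ/∂vec(A)` at the observation `z`. -/
def score (n : Fin K → ℕ) (ν : Fin K → ℝ) (vp : ∀ k, Matrix (Fin (n k)) (Fin (n k - 1)) ℝ)
    (A : Matrix (Fin K) (Fin K) ℝ) (z : (Σ k, Fin (n k)) → ℝ) : EuclideanSpace ℝ (Fin K × Fin K) :=
  gradient (logLik n ν vp z) (WithLp.toLp 2 A.vec)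

/-! ### The quantities in the formulas -/

/-- The standardized canonical variables `X = Q'U`, `U = C^{-1/2} Z`. The coordinate `Sum.inl k` is
`X_{0,k}`, and the coordinates `Sum.inr ⟨k, ·⟩` form the vector `X_k`. -/
def canonX (n : Fin K → ℕ) (vp : ∀ k, Matrix (Fin (n k)) (Fin (n k - 1)) ℝ)
    (C : Matrix (Σ k, Fin (n k)) (Σ k, Fin (n k)) ℝ) (z : (Σ k, Fin (n k)) → ℝ) :
    (Fin K ⊕ Σ k, Fin (n k - 1)) → ℝ :=
  (canonQ n vp)ᵀ *ᵥ ((principalSqrt C)⁻¹ *ᵥ z)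

variable (n : Fin K → ℕ) (ν : Fin K → ℝ) (A : Matrix (Fin K) (Fin K) ℝ)
  (X : (Fin K ⊕ Σ k, Fin (n k - 1)) → ℝ)

/-- The vector `X_0`. -/
def X0 : Fin K → ℝ := fun k => X (Sum.inl k)

/-- The vector `X_k`. -/
def Xk (k : Fin K) : Fin (n k - 1) → ℝ := fun i => X (Sum.inr ⟨k, i⟩)

/-- `W_k = (ν_k + n_k) / (ν_k - 2 + X_{0,k}² + X_k'X_k)`. -/
def W (k : Fin K) : ℝ :=
  (ν k + n k) / (ν k - 2 + X0 n X k ^ 2 + Xk n X k ⬝ᵥ Xk n X k)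

/-- `S_k = 1/λ_k - W_k X_k'X_k / (λ_k (n_k - 1))`. -/
def S (k : Fin K) : ℝ :=
  1 / lam n A k - W n ν X k * (Xk n X k ⬝ᵥ Xk n X k) / (lam n A k * ((n k : ℝ) - 1))

/-- `φ_k = (ν_k + n_k) / (ν_k + n_k + 2)`. -/
def phi (k : Fin K) : ℝ := (ν k + n k) / (ν k + n k + 2)

/-- `ψ_k = φ_k ν_k / (ν_k - 2)`. -/
def psi (k : Fin K) : ℝ := phi n ν k * (ν k / (ν k - 2))

/-- `Ω_A = (I_K ⊗ A^{-1/2}) (A^{1/2} ⊕ I_K)^{-1}`. -/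
def Omega : Matrix (Fin K × Fin K) (Fin K × Fin K) ℝ :=
  ((1 : Matrix (Fin K) (Fin K) ℝ) ⊗ₖ (principalSqrt A)⁻¹) * (kronSum (principalSqrt A) 1)⁻¹

/-- The diagonal matrix `Ξ`. -/
def Xi : Matrix (Fin K) (Fin K) ℝ :=
  Matrix.diagonal fun k =>
    (phi n ν k - 1) / lam n A k ^ 2 + 2 * phi n ν k / (lam n A k ^ 2 * ((n k : ℝ) - 1))

/-- `Θ = ∑_k λ_k⁻¹ (1 - φ_k) e_k vec(J_k)'`. -/
def Theta : Matrix (Fin K) (Fin K × Fin K) ℝ :=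
  ∑ k, ((lam n A k)⁻¹ * (1 - phi n ν k)) • vecMulVec (Pi.single k 1) (unitJ k).vec

/-- `Ψ_k = ψ_k (I ⊗ J_k) + (φ_k - ψ_k) J_k ⊗ J_k
+ (φ_k - 1) [(J_k ⊗ J_k) K_K + vec(J_k) vec(J_k)']`. -/
def Psi (k : Fin K) : Matrix (Fin K × Fin K) (Fin K × Fin K) ℝ :=
  psi n ν k • ((1 : Matrix (Fin K) (Fin K) ℝ) ⊗ₖ unitJ k)
    + (phi n ν k - psi n ν k) • (unitJ k ⊗ₖ unitJ k)
    + (phi n ν k - 1) • ((unitJ k ⊗ₖ unitJ k) * commMat (Fin K)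
        + vecMulVec (unitJ k).vec (unitJ k).vec)

/-- `Υ_K = ∑_k Ψ_k`. -/
def Upsilon : Matrix (Fin K × Fin K) (Fin K × Fin K) ℝ := ∑ k, Psi n ν k

end ClusterT

end

/-! Everything is block diagonal in the basis `Q`: the principal root of `C(B)` is `Q diag(B^{1/2},
√λ_k) Q'`. A cluster density depends only on a squared length, which splits into the squared
component along `v_{n_k}` and the squared length of the rest. Hence `ℓ(B; z)` is `-log |det
B^{1/2}|`, minus `∑ (n_k - 1)/2 log λ_k`, plus terms in `(B^{-1/2} y_0)_k` and `|y_k|² / λ_k`, where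
`y = Q'z` (`log_ctDensity_canonM`).

Score. Since `B` runs over all matrices near `A`, its root need not be symmetric. The inverse
function theorem for `S ↦ S²` gives a smooth local root (`exists_local_sqrt`). It keeps a positive
quadratic form, which forces eigenvalues with positive real part, so by uniqueness it is the
principal root. Its derivative `D` in the direction `H` is known only through the Sylvester equation
`R D + D R = H`, `R = A^{1/2}`. This suffices: the chain rule produces `tr (G' R⁻¹ D)`, and `Ω_A vec
G` represents this functional of `H` because `R ⊕ I` is the matrix of the Sylvester operator
(`omega_mulVec_vec_dotProduct`). The dependence of `λ_k` on `B_kk` gives the term in `S`.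

Information. The score is the fixed matrix `(Ω_A, E_d'/2)` applied to a standardized score, a
function of the independent vectors `V_k`. So only the second moments of the latter are needed
(`hasMean_stdScore_mul`). Products of entries that are odd in some cluster vanish on reversing its
sign, products over different clusters factor, and the rest reduce to means of `W^j (v'x)^{2i}`
under one `t` law. As `W^j` only raises the exponent of the density, these are Gamma quotients
(`stdT_moment`). -/

namespace ClusterT

/-! ### Principal square roots and the Sylvester equation. -/

section Sqrt
variable {m : Type*} [Fintype m]

/-- By homogeneity only the unit sphere matters, and it is compact. No symmetry is assumed, as the
perturbed roots are not symmetric. -/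
theorem eventually_forall_dotProduct_pos {M : Matrix m m ℝ} (hM : ∀ x ≠ 0, 0 < x ⬝ᵥ M *ᵥ x) :
    ∀ᶠ N in nhds M, ∀ x ≠ 0, 0 < x ⬝ᵥ N *ᵥ x := by
  have hc : Continuous fun p : Matrix m m ℝ × (m → ℝ) => p.2 ⬝ᵥ p.1 *ᵥ p.2 := by fun_prop
  have h := (isCompact_sphere (0 : m → ℝ) 1).eventually_forall_of_forall_eventually
    (x₀ := M) (P := fun N x => 0 < x ⬝ᵥ N *ᵥ x) fun x hx =>
      hc.continuousAt.eventually
        (lt_mem_nhds (hM x (by rintro rfl; simp at hx)))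
  filter_upwards [h] with N hN x hx
  have hx' : 0 < ‖x‖ := norm_pos_iff.2 hx
  have := hN (‖x‖⁻¹ • x) (by simp [norm_smul, hx'.ne'])
  rw [Matrix.mulVec_smul, dotProduct_smul, smul_dotProduct, smul_eq_mul, smul_eq_mul] at this
  have h2 : 0 < ‖x‖⁻¹ := inv_pos.2 hx'
  exact pos_of_mul_pos_right (pos_of_mul_pos_right this h2.le) h2.le

theorem _root_.Matrix.PosDef.dotProduct_real_pos {M : Matrix m m ℝ} (hM : M.PosDef) :
    ∀ x ≠ 0, 0 < x ⬝ᵥ M *ᵥ x := fun x hx => by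
  simpa using hM.dotProduct_mulVec_pos hx

variable [DecidableEq m]

/-- `Y` intertwines `S` and `-R`, hence also `p(S)` and `p(-R)` for every polynomial `p`. For `p`
the characteristic polynomial of `S`, Cayley–Hamilton gives `p(S) = 0`, while `p(-R)` is invertible
because the spectra of `S` and `-R` lie in opposite open half planes. -/
theorem eq_zero_of_mul_add_mul_eq_zero {S R Y : Matrix m m ℂ} (hS : ∀ μ ∈ spectrum ℂ S, 0 < μ.re)
    (hR : ∀ μ ∈ spectrum ℂ R, 0 < μ.re) (h : S * Y + Y * R = 0) : Y = 0 := by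
  have h1 : S * Y = Y * (-R) := by rw [mul_neg]; exact eq_neg_of_add_eq_zero_left h
  have h2 : ∀ p : Polynomial ℂ, Polynomial.aeval S p * Y = Y * Polynomial.aeval (-R) p := by
    intro p
    induction p using Polynomial.induction_on' with
    | add p q hp hq => simp only [map_add, add_mul, mul_add, hp, hq]
    | monomial k c =>
      have : SemiconjBy Y ((-R) ^ k) (S ^ k) := SemiconjBy.pow_right h1.symm k
      simp only [Polynomial.aeval_monomial, Algebra.algebraMap_eq_smul_one, smul_mul_assoc, one_mul,
        mul_smul_comm, this.eq]
  have h3 := h2 S.charpoly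
  rw [Matrix.aeval_self_charpoly, zero_mul] at h3
  have h4 : IsUnit (Polynomial.aeval (-R) S.charpoly) := by
    cases isEmpty_or_nonempty m
    · exact isUnit_of_subsingleton _
    rw [← spectrum.zero_notMem_iff ℂ]
    intro h0
    rw [spectrum.map_polynomial_aeval_of_nonempty _ _
      (spectrum.nonempty_of_isAlgClosed_of_finiteDimensional ℂ (-R))] at h0
    obtain ⟨r, hr, hr0⟩ := h0
    have ha := hS r (Matrix.mem_spectrum_iff_isRoot_charpoly.2 hr0)
    have hb := hR (-r) (by rw [← spectrum.neg_eq] at hr; simpa using hr)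
    simp only [Complex.neg_re] at hb
    linarith
  exact (h4.mul_left_eq_zero).1 h3.symm

theorem IsPrincipalSqrt.unique {S R B : Matrix m m ℝ} (hS : IsPrincipalSqrt S B)
    (hR : IsPrincipalSqrt R B) : S = R := by
  -- Equal squares make the difference of the two roots a solution of a homogeneous Sylvester
  -- equation.
  have h : S * (S - R) + (S - R) * R = 0 := by
    have := hS.1.trans hR.1.symm
    rw [mul_sub, sub_mul, this]; abel
  have h2 := congrArg (fun M : Matrix m m ℝ => M.map (Complex.ofRealHom)) h
  simp only [Matrix.map_add _ (map_add Complex.ofRealHom), Matrix.map_mul] at h2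
  have h3 : (S - R).map Complex.ofRealHom = 0 := by
    refine eq_zero_of_mul_add_mul_eq_zero hS.2 hR.2 (h2.trans ?_)
    ext; simp
  ext i j
  have := congrFun (congrFun h3 i) j
  simp only [Matrix.map_apply, Matrix.zero_apply, Complex.ofRealHom_eq_coe, Complex.ofReal_eq_zero,
    Matrix.sub_apply] at this
  linarith

theorem IsPrincipalSqrt.principalSqrt_eq {S B : Matrix m m ℝ} (hS : IsPrincipalSqrt S B) :
    principalSqrt B = S := by
  have h : ∃ S : Matrix m m ℝ, IsPrincipalSqrt S B := ⟨S, hS⟩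
  rw [principalSqrt, dif_pos h]
  exact h.choose_spec.unique hS

/-- For an eigenvector `a + ib`, the real and imaginary parts of the eigenvalue equation combine to
`a'Ma + b'Mb = Re μ (|a|² + |b|²)`. -/
theorem re_pos_of_forall_dotProduct_pos {M : Matrix m m ℝ} (hM : ∀ x ≠ 0, 0 < x ⬝ᵥ M *ᵥ x) :
    ∀ μ ∈ spectrum ℂ (M.map (fun x : ℝ => (x : ℂ))), 0 < μ.re := by
  intro μ hμ
  rw [← Matrix.spectrum_toLin', ← Module.End.hasEigenvalue_iff_mem_spectrum] at hμ
  obtain ⟨v, hv⟩ := hμ.exists_hasEigenvector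
  have hv1 := hv.apply_eq_smul
  rw [Matrix.toLin'_apply] at hv1
  set a : m → ℝ := fun i => (v i).re with ha
  set b : m → ℝ := fun i => (v i).im with hb
  have h1 : M *ᵥ a = μ.re • a - μ.im • b := by
    ext i
    have := congrArg Complex.re (congrFun hv1 i)
    simpa [Matrix.mulVec, dotProduct, ha, hb] using this
  have h2 : M *ᵥ b = μ.re • b + μ.im • a := by
    ext i
    have := congrArg Complex.im (congrFun hv1 i)
    simpa [Matrix.mulVec, dotProduct, ha, hb] using this
  have h3 : a ⬝ᵥ M *ᵥ a + b ⬝ᵥ M *ᵥ b = μ.re * (a ⬝ᵥ a + b ⬝ᵥ b) := by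
    rw [h1, h2]
    simp only [dotProduct_sub, dotProduct_add, dotProduct_smul, smul_eq_mul, dotProduct_comm b a]
    ring
  have hnn : ∀ x : m → ℝ, 0 ≤ x ⬝ᵥ M *ᵥ x := fun x => by
    rcases eq_or_ne x 0 with rfl | h
    · simp
    · exact (hM x h).le
  have hsq : ∀ x : m → ℝ, 0 ≤ x ⬝ᵥ x := fun x => Finset.sum_nonneg fun i _ => mul_self_nonneg _
  have h4 : a ≠ 0 ∨ b ≠ 0 := by
    by_contra! hc
    refine hv.2 (funext fun i => Complex.ext ?_ ?_)
    · exact congrFun hc.1 i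
    · exact congrFun hc.2 i
  have h5 : 0 < μ.re * (a ⬝ᵥ a + b ⬝ᵥ b) := by
    rw [← h3]
    rcases h4 with h | h
    · linarith [hM a h, hnn b]
    · linarith [hM b h, hnn a]
  exact pos_of_mul_pos_left h5 (add_nonneg (hsq _) (hsq _))

theorem _root_.Matrix.PosDef.exists_posDef_sqrt {B : Matrix m m ℝ} (hB : B.PosDef) :
    ∃ R : Matrix m m ℝ, R.PosDef ∧ R * R = B := by
  set U : Matrix m m ℝ := (hB.1.eigenvectorUnitary : Matrix m m ℝ)
  have hU : U * star U = 1 := Unitary.coe_mul_star_self _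
  have hU' : star U * U = 1 := Unitary.coe_star_mul_self _
  have hs : B = U * diagonal hB.1.eigenvalues * star U := by
    have := hB.1.spectral_theorem
    simpa [Unitary.conjStarAlgAut_apply] using this
  refine ⟨U * diagonal (fun i => √(hB.1.eigenvalues i)) * star U, ?_, ?_⟩
  · refine (Matrix.PosDef.diagonal fun i => Real.sqrt_pos.2 (hB.eigenvalues_pos i)).mul_mul_conjTranspose_same ?_
    exact Matrix.vecMul_injective_of_isUnit (IsUnit.of_mul_eq_one _ hU)
  · conv_rhs => rw [hs]
    have : diagonal hB.1.eigenvalues = diagonal (fun i => √(hB.1.eigenvalues i)) *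
        diagonal (fun i => √(hB.1.eigenvalues i)) := by
      rw [diagonal_mul_diagonal]
      congr 1; ext i
      exact (Real.mul_self_sqrt (hB.eigenvalues_pos i).le).symm
    rw [this]
    calc _ = U * diagonal (fun i => √(hB.1.eigenvalues i)) * (star U * U) *
          diagonal (fun i => √(hB.1.eigenvalues i)) * star U := by simp only [Matrix.mul_assoc]
      _ = _ := by rw [hU']; simp only [Matrix.mul_assoc, Matrix.mul_one]

theorem isPrincipalSqrt_of_pos {M B : Matrix m m ℝ} (hM : ∀ x ≠ 0, 0 < x ⬝ᵥ M *ᵥ x)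
    (h : M * M = B) : IsPrincipalSqrt M B := ⟨h, re_pos_of_forall_dotProduct_pos hM⟩

theorem _root_.Matrix.PosDef.principalSqrt {B : Matrix m m ℝ} (hB : B.PosDef) :
    (ClusterT.principalSqrt B).PosDef ∧ ClusterT.principalSqrt B * ClusterT.principalSqrt B = B := by
  obtain ⟨R, hR, h⟩ := hB.exists_posDef_sqrt
  rw [(isPrincipalSqrt_of_pos hR.dotProduct_real_pos h).principalSqrt_eq]
  exact ⟨hR, h⟩

theorem isUnit_det_of_pos {M : Matrix m m ℝ} (hM : ∀ x ≠ 0, 0 < x ⬝ᵥ M *ᵥ x) : IsUnit M.det := by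
  rw [← Matrix.isUnit_iff_isUnit_det, ← Matrix.mulVec_injective_iff_isUnit]
  refine (injective_iff_map_eq_zero (Matrix.mulVecLin M)).2 fun x hx => ?_
  by_contra h
  have := hM x h
  rw [Matrix.mulVecLin_apply] at hx
  simp [hx] at this

theorem eq_zero_of_pos_of_mul_add_mul_eq_zero {R Y : Matrix m m ℝ}
    (hR : ∀ x ≠ 0, 0 < x ⬝ᵥ R *ᵥ x) (h : R * Y + Y * R = 0) : Y = 0 := by
  have h2 := congrArg (fun M : Matrix m m ℝ => M.map (Complex.ofRealHom)) h
  simp only [Matrix.map_add _ (map_add Complex.ofRealHom), Matrix.map_mul] at h2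
  have hr := re_pos_of_forall_dotProduct_pos hR
  have h3 : Y.map Complex.ofRealHom = 0 := by
    refine eq_zero_of_mul_add_mul_eq_zero hr hr (h2.trans ?_)
    ext; simp
  ext i j
  have := congrFun (congrFun h3 i) j
  simpa using this

end Sqrt
-- The canonical form of block matrices.
section Canonical
variable {K : ℕ} {n : Fin K → ℕ} {vp : ∀ k, Matrix (Fin (n k)) (Fin (n k - 1)) ℝ}

theorem unitVec_dotProduct_self {m : ℕ} (hm : m ≠ 0) : unitVec m ⬝ᵥ unitVec m = 1 := by
  have : (m : ℝ) ≠ 0 := Nat.cast_ne_zero.2 hm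
  simp [unitVec, dotProduct, ← mul_inv, this]

/-- The matrix `(v, v^⊥)` is square with orthonormal columns, so its rows are orthonormal too. -/
theorem IsOrthoComplement.vecMulVec_add_mul_transpose (hn : ∀ k, 2 ≤ n k)
    (hvp : IsOrthoComplement n vp) (k : Fin K) :
    vecMulVec (unitVec (n k)) (unitVec (n k)) + vp k * (vp k)ᵀ = 1 := by
  have h1 := unitVec_dotProduct_self (m := n k) (by have := hn k; omega)
  set F : Matrix (Fin (n k)) (Unit ⊕ Fin (n k - 1)) ℝ :=
    fromCols (replicateCol Unit (unitVec (n k))) (vp k)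
  have h2 : Fᵀ * F = 1 := by
    rw [transpose_fromCols, fromRows_mul_fromCols, ← fromBlocks_one, (hvp k).1]
    have h3 : (replicateCol Unit (unitVec (n k)))ᵀ * vp k = 0 := by
      ext i j
      exact congrFun (hvp k).2 j
    have h4 : (vp k)ᵀ * (replicateCol Unit (unitVec (n k))) = 0 := by
      rw [← transpose_eq_zero, transpose_mul, transpose_transpose, h3]
    rw [h3, h4]
    congr 1
    ext i j
    simpa [Matrix.mul_apply, dotProduct] using h1
  have h5 : F * Fᵀ = 1 := by
    rw [Matrix.mul_eq_one_comm_of_card_eq]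
    · exact h2
    · have := hn k
      simp; omega
  rw [← h5, transpose_fromCols, fromCols_mul_fromRows]
  congr 1
  ext i j
  simp [Matrix.mul_apply, vecMulVec_apply]

theorem IsOrthoComplement.dotProduct_self_eq (hn : ∀ k, 2 ≤ n k)
    (hvp : IsOrthoComplement n vp) (k : Fin K) (x : Fin (n k) → ℝ) :
    x ⬝ᵥ x = (unitVec (n k) ⬝ᵥ x) ^ 2 + ((vp k)ᵀ *ᵥ x) ⬝ᵥ ((vp k)ᵀ *ᵥ x) := by
  have h : x = (unitVec (n k) ⬝ᵥ x) • unitVec (n k) + vp k *ᵥ ((vp k)ᵀ *ᵥ x) := by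
    conv_lhs => rw [← Matrix.one_mulVec x, ← hvp.vecMulVec_add_mul_transpose hn k, Matrix.add_mulVec,
      vecMulVec_mulVec, ← Matrix.mulVec_mulVec]
    simp
  calc x ⬝ᵥ x = x ⬝ᵥ ((unitVec (n k) ⬝ᵥ x) • unitVec (n k) + vp k *ᵥ ((vp k)ᵀ *ᵥ x)) := by rw [← h]
    _ = _ := by
      rw [dotProduct_add, dotProduct_smul, Matrix.dotProduct_mulVec, ← Matrix.mulVec_transpose,
        dotProduct_comm x, smul_eq_mul, sq]

theorem canonQ_transpose_mulVec_inl (u : (Σ k, Fin (n k)) → ℝ) (k : Fin K) :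
    ((canonQ n vp)ᵀ *ᵥ u) (Sum.inl k) = unitVec (n k) ⬝ᵥ fun i => u ⟨k, i⟩ := by
  simp only [Matrix.mulVec, dotProduct, canonQ, transpose_apply, fromCols_apply_inl, of_apply,
    Fintype.sum_sigma]
  rw [Finset.sum_eq_single k]
  · simp
  · intro l _ hl; simp [hl]
  · simp

theorem canonQ_transpose_mulVec_inr (u : (Σ k, Fin (n k)) → ℝ) (k : Fin K) (j : Fin (n k - 1)) :
    ((canonQ n vp)ᵀ *ᵥ u) (Sum.inr ⟨k, j⟩) = ((vp k)ᵀ *ᵥ fun i => u ⟨k, i⟩) j := by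
  simp only [Matrix.mulVec, dotProduct, canonQ, transpose_apply, fromCols_apply_inr,
    Fintype.sum_sigma]
  rw [Finset.sum_eq_single k]
  · simp
  · intro l _ hl; simp [blockDiagonal'_apply, hl]
  · simp

/-- The matrix with canonical blocks `T` and `s k • 1`. -/
noncomputable def canonM (n : Fin K → ℕ) (vp : ∀ k, Matrix (Fin (n k)) (Fin (n k - 1)) ℝ)
    (T : Matrix (Fin K) (Fin K) ℝ) (s : Fin K → ℝ) :
    Matrix (Σ k, Fin (n k)) (Σ k, Fin (n k)) ℝ :=
  canonQ n vp * fromBlocks T 0 0 (diagonal fun i : Σ k, Fin (n k - 1) => s i.1) * (canonQ n vp)ᵀ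

theorem canonC_eq_canonM (B : Matrix (Fin K) (Fin K) ℝ) :
    canonC n vp B = canonM n vp B (lam n B) := rfl

/-- The matrices `v^⊥` enter only through the projections `v^⊥ (v^⊥)' = I - v v'`, so the choice of
`vp` disappears. The term `s / n` comes from `v v'`. -/
theorem canonM_apply (hn : ∀ k, 2 ≤ n k) (hvp : IsOrthoComplement n vp)
    (T : Matrix (Fin K) (Fin K) ℝ) (s : Fin K → ℝ) (i j : Σ k, Fin (n k)) :
    canonM n vp T s i j = T i.1 j.1 * (1 / √(n i.1) * (1 / √(n j.1))) +
      (if i = j then s i.1 else 0) - (if i.1 = j.1 then s i.1 / n i.1 else 0) := by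
  have h0 : canonM n vp T s =
      (of fun (i : Σ k, Fin (n k)) k => if i.1 = k then unitVec (n i.1) i.2 else 0) * T *
        (of fun (i : Σ k, Fin (n k)) k => if i.1 = k then unitVec (n i.1) i.2 else 0)ᵀ +
      blockDiagonal' fun k => s k • (vp k * (vp k)ᵀ) := by
    have hd : (diagonal fun i : Σ k, Fin (n k - 1) => s i.1) =
        blockDiagonal' fun k => s k • (1 : Matrix (Fin (n k - 1)) (Fin (n k - 1)) ℝ) := by
      ext ⟨k, i⟩ ⟨l, j⟩
      by_cases h : k = l
      · subst h
        by_cases h' : i = j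
        · simp [h']
        · simp [h']
      · rw [blockDiagonal'_apply_ne _ _ _ h, diagonal_apply_ne]
        simp [h]
    rw [canonM, hd, canonQ, fromCols_mul_fromBlocks, transpose_fromCols, fromCols_mul_fromRows]
    simp only [Matrix.mul_zero, add_zero, zero_add]
    congr 1
    rw [blockDiagonal'_transpose, ← blockDiagonal'_mul, ← blockDiagonal'_mul]
    congr 1
    ext k : 1
    simp
  rw [h0]
  obtain ⟨k, i⟩ := i
  obtain ⟨l, j⟩ := j
  have h1 : ((of fun (i : Σ k, Fin (n k)) k => if i.1 = k then unitVec (n i.1) i.2 else 0) * T *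
        (of fun (i : Σ k, Fin (n k)) k => if i.1 = k then unitVec (n i.1) i.2 else 0)ᵀ) ⟨k, i⟩ ⟨l, j⟩
      = T k l * (1 / √(n k) * (1 / √(n l))) := by
    simp [Matrix.mul_apply, unitVec]
    ring
  rw [Matrix.add_apply, h1, add_sub_assoc]
  congr 1
  by_cases h : k = l
  · subst h
    have hp : vp k * (vp k)ᵀ = 1 - vecMulVec (unitVec (n k)) (unitVec (n k)) :=
      eq_sub_of_add_eq' (hvp.vecMulVec_add_mul_transpose hn k)
    have hnk : (n k : ℝ) ≠ 0 := by have := hn k; positivity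
    rw [blockDiagonal'_apply_eq, hp]
    by_cases h' : i = j
    · simp [h', vecMulVec_apply, unitVec, ← mul_inv]; ring
    · simp [h', vecMulVec_apply, unitVec, ← mul_inv]; ring
  · rw [blockDiagonal'_apply_ne _ _ _ h]
    simp [h]

theorem canonM_one (hn : ∀ k, 2 ≤ n k) (hvp : IsOrthoComplement n vp) :
    canonM n vp 1 (fun _ => 1) = 1 := by
  ext ⟨k, i⟩ ⟨l, j⟩
  rw [canonM_apply hn hvp]
  have hnk : (n k : ℝ) ≠ 0 := by have := hn k; positivity
  by_cases h : k = l
  · subst h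
    simp [Matrix.one_apply, ← mul_inv]
  · simp [h]

theorem canonQ_mul_transpose (hn : ∀ k, 2 ≤ n k) (hvp : IsOrthoComplement n vp) :
    canonQ n vp * (canonQ n vp)ᵀ = 1 := by
  have := canonM_one hn hvp
  simpa [canonM] using this

theorem canonQ_transpose_mul (hn : ∀ k, 2 ≤ n k) (hvp : IsOrthoComplement n vp) :
    (canonQ n vp)ᵀ * canonQ n vp = 1 := by
  rw [Matrix.mul_eq_one_comm_of_card_eq]
  · exact canonQ_mul_transpose hn hvp
  · have : (Fintype.card (Fin K) : ℕ) = ∑ k : Fin K, 1 := by simp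
    rw [Fintype.card_sum, this, Fintype.card_sigma, Fintype.card_sigma, ← Finset.sum_add_distrib]
    refine Finset.sum_congr rfl fun k _ => ?_
    have := hn k
    simp; omega

/-- Since `Q'Q = I`, canonical matrices multiply blockwise, which reduces their roots and inverses
to those of `T` and `s`. -/
theorem canonM_mul (hn : ∀ k, 2 ≤ n k) (hvp : IsOrthoComplement n vp)
    (T T' : Matrix (Fin K) (Fin K) ℝ) (s s' : Fin K → ℝ) :
    canonM n vp T s * canonM n vp T' s' = canonM n vp (T * T') (fun k => s k * s' k) := by
  unfold canonM
  calc _ = canonQ n vp * fromBlocks T 0 0 (diagonal fun i : Σ k, Fin (n k - 1) => s i.1) *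
        ((canonQ n vp)ᵀ * canonQ n vp) *
        fromBlocks T' 0 0 (diagonal fun i : Σ k, Fin (n k - 1) => s' i.1) * (canonQ n vp)ᵀ := by
        simp only [Matrix.mul_assoc]
    _ = _ := by
      rw [canonQ_transpose_mul hn hvp, Matrix.mul_one, Matrix.mul_assoc (canonQ n vp),
        fromBlocks_multiply]
      simp

theorem canonM_inv (hn : ∀ k, 2 ≤ n k) (hvp : IsOrthoComplement n vp)
    {T : Matrix (Fin K) (Fin K) ℝ} (hT : IsUnit T.det) {s : Fin K → ℝ} (hs : ∀ k, s k ≠ 0) :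
    (canonM n vp T s)⁻¹ = canonM n vp T⁻¹ (fun k => (s k)⁻¹) := by
  refine Matrix.inv_eq_right_inv ?_
  rw [canonM_mul hn hvp, Matrix.mul_nonsing_inv _ hT, ← canonM_one hn hvp]
  congr 1
  ext k
  exact mul_inv_cancel₀ (hs k)

theorem canonQ_transpose_mulVec_canonM (hn : ∀ k, 2 ≤ n k) (hvp : IsOrthoComplement n vp)
    (T : Matrix (Fin K) (Fin K) ℝ) (s : Fin K → ℝ) (z : (Σ k, Fin (n k)) → ℝ) :
    (canonQ n vp)ᵀ *ᵥ (canonM n vp T s *ᵥ z) =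
      Sum.elim (T *ᵥ fun k => ((canonQ n vp)ᵀ *ᵥ z) (Sum.inl k))
        (fun i => s i.1 * ((canonQ n vp)ᵀ *ᵥ z) (Sum.inr i)) := by
  unfold canonM
  rw [Matrix.mulVec_mulVec, ← Matrix.mul_assoc, ← Matrix.mul_assoc, canonQ_transpose_mul hn hvp,
    Matrix.one_mul, ← Matrix.mulVec_mulVec, fromBlocks_mulVec]
  simp only [Matrix.zero_mulVec, add_zero, zero_add]
  congr 1
  ext i
  simp [Matrix.mulVec_diagonal]

theorem det_canonM (hn : ∀ k, 2 ≤ n k) (hvp : IsOrthoComplement n vp)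
    (T : Matrix (Fin K) (Fin K) ℝ) (s : Fin K → ℝ) :
    (canonM n vp T s).det = T.det * ∏ k, s k ^ (n k - 1) := by
  rw [canonM, det_conj_of_mul_eq_one (canonQ_mul_transpose hn hvp) (canonQ_transpose_mul hn hvp),
    det_fromBlocks_zero₂₁, det_diagonal, Fintype.prod_sigma]
  simp

theorem canonM_dotProduct_pos (hn : ∀ k, 2 ≤ n k) (hvp : IsOrthoComplement n vp)
    {T : Matrix (Fin K) (Fin K) ℝ} (hT : ∀ x ≠ 0, 0 < x ⬝ᵥ T *ᵥ x) {s : Fin K → ℝ}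
    (hs : ∀ k, 0 < s k) : ∀ x ≠ 0, 0 < x ⬝ᵥ canonM n vp T s *ᵥ x := by
  intro x hx
  set y := (canonQ n vp)ᵀ *ᵥ x with hy
  have hxy : canonQ n vp *ᵥ y = x := by
    rw [hy, Matrix.mulVec_mulVec, canonQ_mul_transpose hn hvp, Matrix.one_mulVec]
  have h1 : x ⬝ᵥ canonM n vp T s *ᵥ x =
      y ⬝ᵥ (fromBlocks T 0 0 (diagonal fun i : Σ k, Fin (n k - 1) => s i.1) *ᵥ y) := by
    rw [canonM, ← Matrix.mulVec_mulVec, ← Matrix.mulVec_mulVec, Matrix.dotProduct_mulVec,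
      ← Matrix.mulVec_transpose]
  have h2 : x ⬝ᵥ canonM n vp T s *ᵥ x = (y ∘ Sum.inl) ⬝ᵥ T *ᵥ (y ∘ Sum.inl) +
      ∑ i : Σ k, Fin (n k - 1), s i.1 * y (Sum.inr i) ^ 2 := by
    rw [h1, fromBlocks_mulVec, dotProduct, Fintype.sum_sum_type]
    simp only [Matrix.zero_mulVec, add_zero, zero_add, Sum.elim_inl, Sum.elim_inr, dotProduct,
      Matrix.mulVec_diagonal, Function.comp_apply]
    congr 1
    exact Finset.sum_congr rfl fun i _ => by ring
  have h3 : 0 ≤ (y ∘ Sum.inl) ⬝ᵥ T *ᵥ (y ∘ Sum.inl) := by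
    rcases eq_or_ne (y ∘ Sum.inl) 0 with h | h
    · simp [h]
    · exact (hT _ h).le
  have h4 : ∀ i ∈ Finset.univ, 0 ≤ s (i : Σ k, Fin (n k - 1)).1 * y (Sum.inr i) ^ 2 :=
    fun i _ => mul_nonneg (hs _).le (sq_nonneg _)
  rw [h2]
  by_cases h : y ∘ Sum.inl = 0
  · have : ∃ i, y (Sum.inr i) ≠ 0 := by
      by_contra! hc
      apply hx
      rw [← hxy]
      have : y = 0 := by
        ext (i | i)
        · exact congrFun h i
        · exact hc i
      simp [this]
    obtain ⟨i, hi⟩ := this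
    exact add_pos_of_nonneg_of_pos h3 (Finset.sum_pos' h4
      ⟨i, Finset.mem_univ _, mul_pos (hs _) (by positivity)⟩)
  · exact add_pos_of_pos_of_nonneg (hT _ h) (Finset.sum_nonneg h4)

theorem blockCorr_eq_canonC (hn : ∀ k, 2 ≤ n k) (hvp : IsOrthoComplement n vp)
    (ρ : Matrix (Fin K) (Fin K) ℝ) : blockCorr n ρ = canonC n vp (canonA n ρ) := by
  ext ⟨k, i⟩ ⟨l, j⟩
  have hnk : (n k : ℝ) ≠ 0 := by have := hn k; positivity
  have hnl : (n l : ℝ) ≠ 0 := by have := hn l; positivity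
  have hnk' : (n k : ℝ) - 1 ≠ 0 := by
    have : (2 : ℝ) ≤ n k := by exact_mod_cast hn k
    linarith
  rw [canonC_eq_canonM, canonM_apply hn hvp]
  by_cases h : k = l
  · subst h
    have h2 : 1 / √(n k : ℝ) * (1 / √(n k : ℝ)) = 1 / n k := by
      simp [← mul_inv]
    have hl : lam n (canonA n ρ) k = 1 - ρ k k := by
      simp only [lam, canonA, of_apply, if_true]
      field_simp
      ring
    simp only [h2, hl]
    simp only [blockCorr, of_apply, canonA, if_true]
    split_ifs <;> field_simp <;> ring
  · simp only [h, blockCorr, of_apply, canonA, if_false, Sigma.mk.injEq, false_and, add_zero,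
      sub_zero]
    rw [Real.sqrt_mul (by positivity)]
    have h1 : √(n k : ℝ) ≠ 0 := by positivity
    have h2 : √(n l : ℝ) ≠ 0 := by positivity
    field_simp

theorem posDef_of_canonM (hn : ∀ k, 2 ≤ n k) (hvp : IsOrthoComplement n vp)
    {T : Matrix (Fin K) (Fin K) ℝ} {s : Fin K → ℝ} (h : (canonM n vp T s).PosDef) :
    T.PosDef ∧ ∀ k, 0 < s k := by
  have h1 : (fromBlocks T 0 0 (diagonal fun i : Σ k, Fin (n k - 1) => s i.1)).PosDef := by
    have h2 := h.conjTranspose_mul_mul_same (B := canonQ n vp) fun x y hxy => by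
      have := congrArg (fun z => (canonQ n vp)ᵀ *ᵥ z) hxy
      simpa only [Matrix.mulVec_mulVec, canonQ_transpose_mul hn hvp, Matrix.one_mulVec] using this
    have h3 : (canonQ n vp)ᴴ * canonM n vp T s * canonQ n vp =
        ((canonQ n vp)ᵀ * canonQ n vp) *
        fromBlocks T 0 0 (diagonal fun i : Σ k, Fin (n k - 1) => s i.1) *
        ((canonQ n vp)ᵀ * canonQ n vp) := by
      simp only [conjTranspose_eq_transpose_of_trivial, canonM, Matrix.mul_assoc]
    rwa [h3, canonQ_transpose_mul hn hvp, Matrix.one_mul, Matrix.mul_one] at h2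
  constructor
  · exact h1.submatrix (e := Sum.inl) Sum.inl_injective
  · intro k
    -- The scalar `s k` does occur on the diagonal, because `n k - 1 ≥ 1`.
    have := h1.diag_pos (i := Sum.inr ⟨k, ⟨0, by have := hn k; omega⟩⟩)
    simpa using this

end Canonical
-- Derivatives of the square root, the log-determinant and the inverse.
section Calculus
open scoped Matrix.Norms.Operator Topology
variable {m : Type*} [Fintype m] [DecidableEq m]

/-- Inverse function theorem for `S ↦ S * S` at `R`: the derivative `Y ↦ R Y + Y R` is injective by
the Sylvester lemma, hence invertible in finite dimension. -/
theorem exists_local_sqrt {R : Matrix m m ℝ} (hR : ∀ x ≠ 0, 0 < x ⬝ᵥ R *ᵥ x) :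
    ∃ (T : Matrix m m ℝ → Matrix m m ℝ) (D : Matrix m m ℝ →L[ℝ] Matrix m m ℝ),
      HasFDerivAt T D (R * R) ∧ T (R * R) = R ∧ (∀ H, R * D H + D H * R = H) ∧
      ∀ᶠ B in 𝓝 (R * R), T B * T B = B := by
  set L : Matrix m m ℝ →ₗ[ℝ] Matrix m m ℝ := LinearMap.mulLeft ℝ R + LinearMap.mulRight ℝ R
  have hinj : Function.Injective L := by
    refine (injective_iff_map_eq_zero L).2 fun Y hY => ?_
    exact eq_zero_of_pos_of_mul_add_mul_eq_zero hR hY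
  set e : Matrix m m ℝ ≃L[ℝ] Matrix m m ℝ :=
    (LinearEquiv.ofInjectiveEndo L hinj).toContinuousLinearEquiv
  have he' : ∀ Y, e Y = R * Y + Y * R := fun Y => rfl
  have hf : HasStrictFDerivAt (fun S : Matrix m m ℝ => S * S)
      (e : Matrix m m ℝ →L[ℝ] Matrix m m ℝ) R := by
    have := (hasStrictFDerivAt_id (𝕜 := ℝ) R).mul' (hasStrictFDerivAt_id R)
    exact this.congr_fderiv (ContinuousLinearMap.ext fun Y => rfl)
  refine ⟨hf.localInverse, e.symm, hf.to_localInverse.hasFDerivAt, hf.localInverse_apply_image,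
    fun H => ?_, hf.eventually_right_inverse⟩
  rw [← he']
  exact e.apply_symm_apply H

/-- Jacobi's formula. The determinant is a polynomial in the entries, so it is differentiable; its
derivative is then read off on lines, from the linear coefficient of `det (1 + t R⁻¹ H)`. -/
theorem hasFDerivAt_log_abs_det {R : Matrix m m ℝ} (hR : IsUnit R.det) :
    HasFDerivAt (fun M : Matrix m m ℝ => Real.log |M.det|)
      (LinearMap.toContinuousLinearMap
        ((Matrix.traceLinearMap m ℝ ℝ) ∘ₗ LinearMap.mulLeft ℝ R⁻¹)) R := by
  have hd : DifferentiableAt ℝ (fun M : Matrix m m ℝ => M.det) R := by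
    have hent : ∀ i j, DifferentiableAt ℝ (fun M : Matrix m m ℝ => M i j) R := fun i j =>
      (LinearMap.toContinuousLinearMap (Matrix.entryLinearMap ℝ ℝ i j)).differentiableAt
    simp only [Matrix.det_apply]
    fun_prop
  have h1 : HasFDerivAt (fun M : Matrix m m ℝ => M.det)
      (R.det • LinearMap.toContinuousLinearMap
        ((Matrix.traceLinearMap m ℝ ℝ) ∘ₗ LinearMap.mulLeft ℝ R⁻¹)) R := by
    refine hd.hasFDerivAt.congr_fderiv ?_
    ext1 H
    have hline : HasDerivAt (fun t : ℝ => R + t • H) H 0 := by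
      have := ((hasDerivAt_id (0 : ℝ)).smul_const H).const_add R
      rwa [one_smul] at this
    have h2 : HasDerivAt (fun t : ℝ => (R + t • H).det)
        (fderiv ℝ (fun M : Matrix m m ℝ => M.det) R H) 0 := by
      have h0 : R + (0 : ℝ) • H = R := by simp
      exact HasFDerivAt.comp_hasDerivAt (0 : ℝ) (f := fun t : ℝ => R + t • H)
        (by rw [h0]; exact hd.hasFDerivAt) hline
    have h3 : (fun t : ℝ => (R + t • H).det) = fun t =>
        R.det * Polynomial.eval t (det (1 + (Polynomial.X : Polynomial ℝ) •
          (R⁻¹ * H).map Polynomial.C)) := by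
      ext t
      have : R + t • H = R * (1 + t • (R⁻¹ * H)) := by
        rw [Matrix.mul_add, Matrix.mul_one, Matrix.mul_smul, ← Matrix.mul_assoc,
          Matrix.mul_nonsing_inv _ hR, Matrix.one_mul]
      rw [this, det_mul]
      congr 1
      rw [← Polynomial.coe_evalRingHom, RingHom.map_det]
      congr 1
      ext i j
      simp only [RingHom.mapMatrix_apply, Matrix.map_apply, Matrix.add_apply, Matrix.smul_apply,
        Matrix.one_apply, smul_eq_mul, map_add, Polynomial.coe_evalRingHom, map_one]
      congr 1
      rw [Polynomial.eval_mul, Polynomial.eval_X, Polynomial.eval_C]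
    rw [h3] at h2
    have h4 := ((det (1 + (Polynomial.X : Polynomial ℝ) •
          (R⁻¹ * H).map Polynomial.C)).hasDerivAt 0).const_mul R.det
    rw [h2.unique h4, derivative_det_one_add_X_smul]
    simp
  have h2 := h1.log hR.ne_zero
  simp only [Real.log_abs]
  refine h2.congr_fderiv (ContinuousLinearMap.ext fun H => ?_)
  exact inv_mul_cancel_left₀ hR.ne_zero ((R⁻¹ * H).trace)

theorem HasFDerivAt.matrix_inv_mulVec {E : Type*} [NormedAddCommGroup E] [NormedSpace ℝ E]
    {T : E → Matrix m m ℝ} {D : E →L[ℝ] Matrix m m ℝ} {x : E} (hT : HasFDerivAt T D x)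
    (hx : IsUnit (T x).det) (y : m → ℝ) (k : m) :
    ∃ D' : E →L[ℝ] ℝ, HasFDerivAt (fun B => ((T B)⁻¹ *ᵥ y) k) D' x ∧
      ∀ H, D' H = -((T x)⁻¹ *ᵥ (D H *ᵥ ((T x)⁻¹ *ᵥ y))) k := by
  set ev : Matrix m m ℝ →L[ℝ] ℝ := LinearMap.toContinuousLinearMap
    ((LinearMap.proj k : (m → ℝ) →ₗ[ℝ] ℝ) ∘ₗ (Matrix.mulVecBilin ℝ ℝ).flip y)
  have hev : ∀ M, ev M = (M *ᵥ y) k := fun M => rfl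
  obtain ⟨u, hu⟩ := (Matrix.isUnit_iff_isUnit_det _).2 hx
  have h1 : HasFDerivAt Ring.inverse _ (T x) := hu ▸ hasFDerivAt_ringInverse (𝕜 := ℝ) u
  refine ⟨_, (ev.hasFDerivAt.comp x (h1.comp x hT)).congr_of_eventuallyEq ?_, fun H => ?_⟩
  · filter_upwards with B
    simp [hev, Matrix.nonsing_inv_eq_ringInverse]
  · have hui : (↑u⁻¹ : Matrix m m ℝ) = (T x)⁻¹ := by rw [← hu, Matrix.coe_units_inv]
    change (-((↑u⁻¹ : Matrix m m ℝ) * D H * (↑u⁻¹ : Matrix m m ℝ)) *ᵥ y) k = _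
    rw [hui, Matrix.mulVec_mulVec, Matrix.mulVec_mulVec, Matrix.neg_mulVec, Matrix.mul_assoc]
    rfl

/-- `unvec` as a continuous linear map. -/
noncomputable def unvecL (m : Type*) [Fintype m] [DecidableEq m] :
    EuclideanSpace ℝ (m × m) →L[ℝ] Matrix m m ℝ :=
  LinearMap.toContinuousLinearMap
    { toFun := unvec
      map_add' := fun _ _ => rfl
      map_smul' := fun _ _ => rfl }

/-- Collects, in the coordinates `vec B`, all that the likelihood needs of the local root `T`. Its
derivative `D` enters only through the Sylvester equation, so a bare function is enough. -/
theorem exists_local_sqrt_unvec {R : Matrix m m ℝ} (hR : ∀ x ≠ 0, 0 < x ⬝ᵥ R *ᵥ x)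
    {a : EuclideanSpace ℝ (m × m)} (ha : unvec a = R * R) :
    ∃ (T D : EuclideanSpace ℝ (m × m) → Matrix m m ℝ),
      ContinuousAt T a ∧ T a = R ∧ (∀ᶠ b in 𝓝 a, T b * T b = unvec b) ∧
      (∀ h, R * D h + D h * R = unvec h) ∧
      (∃ L : EuclideanSpace ℝ (m × m) →L[ℝ] ℝ, HasFDerivAt (fun b => Real.log |(T b).det|) L a ∧
        ∀ h, L h = (R⁻¹ * D h).trace) ∧
      ∀ y k, ∃ L : EuclideanSpace ℝ (m × m) →L[ℝ] ℝ,
        HasFDerivAt (fun b => ((T b)⁻¹ *ᵥ y) k) L a ∧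
        ∀ h, L h = -(R⁻¹ *ᵥ (D h *ᵥ (R⁻¹ *ᵥ y))) k := by
  obtain ⟨T, D, hT, hTR, hD, hev⟩ := exists_local_sqrt hR
  rw [← ha] at hT hTR hev
  have hu : HasFDerivAt (fun b : EuclideanSpace ℝ (m × m) => unvec b) (unvecL m) a :=
    (unvecL m).hasFDerivAt
  have hTu : HasFDerivAt (fun b => T (unvec b)) _ a := HasFDerivAt.comp a hT hu
  have hdet := isUnit_det_of_pos hR
  refine ⟨fun b => T (unvec b), fun h => D (unvec h), hTu.continuousAt, hTR,
    hu.continuousAt.eventually hev, fun h => hD _, ?_, fun y k => ?_⟩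
  · have hlog := (hasFDerivAt_log_abs_det (hTR.symm ▸ hdet : IsUnit (T (unvec a)).det)).comp a hTu
    refine ⟨_, hlog, fun h => ?_⟩
    rw [← hTR]
    rfl
  · obtain ⟨L, hL, hL'⟩ := HasFDerivAt.matrix_inv_mulVec hTu (hTR.symm ▸ hdet) y k
    refine ⟨L, hL, fun h => ?_⟩
    rw [hL', hTR]
    rfl

end Calculus

/-! ### The log-likelihood in canonical coordinates. -/

section Likelihood
variable {K : ℕ} {n : Fin K → ℕ} {vp : ∀ k, Matrix (Fin (n k)) (Fin (n k - 1)) ℝ}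

theorem log_stdTDensity {ν : ℝ} (hν : 2 < ν) (m : ℕ) (x : Fin m → ℝ) :
    Real.log (stdTDensity ν m x) =
      Real.log (Real.Gamma ((ν + m) / 2) / Real.Gamma (ν / 2) *
        ((ν - 2) * Real.pi) ^ (-(m : ℝ) / 2)) -
      (ν + m) / 2 * Real.log (1 + (x ⬝ᵥ x) / (ν - 2)) := by
  have h1 : 0 < Real.Gamma ((ν + m) / 2) := Real.Gamma_pos_of_pos (by positivity)
  have h2 : 0 < Real.Gamma (ν / 2) := Real.Gamma_pos_of_pos (by positivity)
  have h3 : 0 < (ν - 2) * Real.pi := mul_pos (by linarith) Real.pi_pos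
  have h4 : 0 ≤ x ⬝ᵥ x := Finset.sum_nonneg fun i _ => mul_self_nonneg _
  have h5 : 0 < ν - 2 := by linarith
  have h6 : 0 < 1 + (x ⬝ᵥ x) / (ν - 2) := by positivity
  rw [stdTDensity, Real.log_mul (by positivity) (by positivity), Real.log_rpow h6]
  ring

theorem stdTDensity_pos {ν : ℝ} (hν : 2 < ν) (m : ℕ) (x : Fin m → ℝ) :
    0 < stdTDensity ν m x := by
  have h1 : 0 < Real.Gamma ((ν + m) / 2) := Real.Gamma_pos_of_pos (by positivity)
  have h2 : 0 < Real.Gamma (ν / 2) := Real.Gamma_pos_of_pos (by positivity)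
  have h3 : 0 < (ν - 2) * Real.pi := mul_pos (by linarith) Real.pi_pos
  have h4 : 0 ≤ x ⬝ᵥ x := Finset.sum_nonneg fun i _ => mul_self_nonneg _
  have h5 : 0 < ν - 2 := by linarith
  have h6 : 0 < 1 + (x ⬝ᵥ x) / (ν - 2) := by positivity
  unfold stdTDensity
  positivity

/-- The likelihood decouples: the determinant factors over the canonical blocks, with `√(l k)` of
multiplicity `n k - 1`, and each cluster density sees only a squared norm, split by
`dotProduct_self_eq`. -/
theorem log_ctDensity_canonM (hn : ∀ k, 2 ≤ n k) (hvp : IsOrthoComplement n vp) {ν : Fin K → ℝ}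
    (hν : ∀ k, 2 < ν k) {T : Matrix (Fin K) (Fin K) ℝ} (hT : IsUnit T.det) {l : Fin K → ℝ}
    (hl : ∀ k, 0 < l k) (z : (Σ k, Fin (n k)) → ℝ) :
    Real.log (ctDensity n ν (canonM n vp T fun k => √(l k)) z) =
      -Real.log |T.det| - ∑ k, ((n k : ℝ) - 1) / 2 * Real.log (l k) +
      ∑ k, (Real.log (Real.Gamma ((ν k + n k) / 2) / Real.Gamma (ν k / 2) *
        ((ν k - 2) * Real.pi) ^ (-(n k : ℝ) / 2)) - (ν k + n k) / 2 *
        Real.log (1 + ((T⁻¹ *ᵥ X0 n ((canonQ n vp)ᵀ *ᵥ z)) k ^ 2 +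
          (Xk n ((canonQ n vp)ᵀ *ᵥ z) k ⬝ᵥ Xk n ((canonQ n vp)ᵀ *ᵥ z) k) * (l k)⁻¹) / (ν k - 2))) := by
  have hs : ∀ k, √(l k) ≠ 0 := fun k => (Real.sqrt_pos.2 (hl k)).ne'
  have hd : (canonM n vp T fun k => √(l k)).det ≠ 0 := by
    rw [det_canonM hn hvp]
    exact mul_ne_zero hT.ne_zero (Finset.prod_ne_zero_iff.2 fun k _ => pow_ne_zero _ (hs k))
  rw [ctDensity, Real.log_mul (inv_ne_zero (abs_ne_zero.2 hd))
    (Finset.prod_ne_zero_iff.2 fun k _ => (stdTDensity_pos (hν k) _ _).ne'),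
    Real.log_inv, Real.log_prod fun k _ => (stdTDensity_pos (hν k) _ _).ne']
  congr 1
  · rw [det_canonM hn hvp, Real.log_abs, Real.log_mul hT.ne_zero
      (Finset.prod_ne_zero_iff.2 fun k _ => pow_ne_zero _ (hs k)),
      Real.log_prod fun k _ => pow_ne_zero _ (hs k), Real.log_abs, neg_add, ← sub_eq_add_neg]
    congr 1
    refine Finset.sum_congr rfl fun k _ => ?_
    have := hn k
    rw [Real.log_pow, Real.log_sqrt (hl k).le, Nat.cast_sub (by omega)]
    push_cast; ring
  · refine Finset.sum_congr rfl fun k _ => ?_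
    rw [log_stdTDensity (hν k), hvp.dotProduct_self_eq hn k, canonM_inv hn hvp hT hs]
    have h1 := canonQ_transpose_mulVec_canonM hn hvp T⁻¹ (fun k => (√(l k))⁻¹) z
    have h2 := congrFun h1 (Sum.inl k)
    rw [canonQ_transpose_mulVec_inl] at h2
    have h3 : ((vp k)ᵀ *ᵥ fun i => (canonM n vp T⁻¹ (fun k => (√(l k))⁻¹) *ᵥ z) ⟨k, i⟩) =
        (√(l k))⁻¹ • Xk n ((canonQ n vp)ᵀ *ᵥ z) k := by
      ext j
      have := congrFun h1 (Sum.inr ⟨k, j⟩)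
      rw [canonQ_transpose_mulVec_inr] at this
      exact this
    rw [h2, h3, smul_dotProduct, dotProduct_smul, smul_smul, smul_eq_mul, ← mul_inv,
      Real.mul_self_sqrt (hl k).le, mul_comm (l k)⁻¹]
    rfl


/-- The log-likelihood as a function of the square root and the eigenvalues has the derivative
`H ↦ tr (Gᵀ R⁻¹ D H) + (∑ S_k H_kk) / 2`, where `G = ∑ W_k X_{0,k} e_k X₀' - I`. -/
theorem hasFDerivAt_canonical_logLik (hn : ∀ k, 2 ≤ n k) {ν : Fin K → ℝ}
    (hν : ∀ k, 2 < ν k) {R : Matrix (Fin K) (Fin K) ℝ}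
    {a : EuclideanSpace ℝ (Fin K × Fin K)} (hl : ∀ k, 0 < lam n (unvec a) k)
    {T D : EuclideanSpace ℝ (Fin K × Fin K) → Matrix (Fin K) (Fin K) ℝ}
    (hTA : T a = R) {L : EuclideanSpace ℝ (Fin K × Fin K) →L[ℝ] ℝ}
    (hL : HasFDerivAt (fun b => Real.log |(T b).det|) L a) (hL' : ∀ h, L h = (R⁻¹ * D h).trace)
    (y : Fin K → ℝ) {L' : Fin K → EuclideanSpace ℝ (Fin K × Fin K) →L[ℝ] ℝ}
    (hx : ∀ k, HasFDerivAt (fun b => ((T b)⁻¹ *ᵥ y) k) (L' k) a)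
    (hx' : ∀ k h, L' k h = -(R⁻¹ *ᵥ (D h *ᵥ (R⁻¹ *ᵥ y))) k)
    (b c : Fin K → ℝ) (hb : ∀ k, 0 ≤ b k)
    {X : (Fin K ⊕ Σ k, Fin (n k - 1)) → ℝ} (hX : X0 n X = R⁻¹ *ᵥ y)
    (hXk : ∀ k, Xk n X k ⬝ᵥ Xk n X k = b k * (lam n (unvec a) k)⁻¹) :
    ∃ M : EuclideanSpace ℝ (Fin K × Fin K) →L[ℝ] ℝ,
      HasFDerivAt (fun e => -Real.log |(T e).det| -
        ∑ k, ((n k : ℝ) - 1) / 2 * Real.log (lam n (unvec e) k) +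
        ∑ k, (c k - (ν k + n k) / 2 * Real.log (1 + (((T e)⁻¹ *ᵥ y) k ^ 2 +
          b k * (lam n (unvec e) k)⁻¹) / (ν k - 2)))) M a ∧
      ∀ h, M h = ∑ k, W n ν X k * X0 n X k * (R⁻¹ *ᵥ (D h *ᵥ X0 n X)) k - (R⁻¹ * D h).trace +
        1 / 2 * ∑ k, S n ν (unvec a) X k * h (k, k) := by
  have hlam : ∀ k, HasFDerivAt (fun e : EuclideanSpace ℝ (Fin K × Fin K) => lam n (unvec e) k)
      ((((n k : ℝ) - 1)⁻¹) • -(EuclideanSpace.proj (k, k) : EuclideanSpace ℝ (Fin K × Fin K) →L[ℝ] ℝ))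
      a := fun k =>
    ((EuclideanSpace.proj (k, k) : EuclideanSpace ℝ (Fin K × Fin K) →L[ℝ] ℝ).hasFDerivAt.const_sub
      (n k : ℝ)).mul_const ((n k : ℝ) - 1)⁻¹
  have h2 : HasFDerivAt (fun e : EuclideanSpace ℝ (Fin K × Fin K) =>
      ∑ k, ((n k : ℝ) - 1) / 2 * Real.log (lam n (unvec e) k)) _ a :=
    HasFDerivAt.fun_sum fun k (_ : k ∈ Finset.univ) => ((hlam k).log (hl k).ne').const_mul _
  have hpos : ∀ k, 0 < 1 + (((T a)⁻¹ *ᵥ y) k ^ 2 + b k * (lam n (unvec a) k)⁻¹) / (ν k - 2) :=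
    fun k => by
      have := hb k
      have := hl k
      have : 0 < ν k - 2 := sub_pos.2 (hν k)
      positivity
  have h3 : HasFDerivAt (fun e => ∑ k, (c k - (ν k + n k) / 2 *
      Real.log (1 + (((T e)⁻¹ *ᵥ y) k ^ 2 + b k * (lam n (unvec e) k)⁻¹) / (ν k - 2)))) _ a :=
    HasFDerivAt.fun_sum fun k (_ : k ∈ Finset.univ) =>
      (((((((hx k).pow 2).add (((hasDerivAt_inv (hl k).ne').comp_hasFDerivAt a (hlam k)).const_mul
        (b k))).mul_const (ν k - 2)⁻¹).const_add 1).log (hpos k).ne').const_mul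
        ((ν k + n k) / 2)).const_sub (c k)
  refine ⟨_, (hL.neg.sub h2).add h3, fun h => ?_⟩
  have hy : ∀ k, (R⁻¹ *ᵥ y) k = X0 n X k := fun k => by rw [hX]
  have hproj : ∀ k, (EuclideanSpace.proj (k, k) : EuclideanSpace ℝ (Fin K × Fin K) →L[ℝ] ℝ) h =
    h (k, k) := fun k => rfl
  simp only [_root_.add_apply, _root_.sub_apply, _root_.neg_apply, _root_.sum_apply,
    _root_.smul_apply, hL', hx', smul_eq_mul, hproj, hTA, nsmul_eq_mul, ← hX, hy, Pi.add_apply,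
    Function.comp_apply]
  rw [sub_eq_add_neg, sub_eq_add_neg, add_comm (∑ k, _) (-trace _), add_assoc, add_assoc,
    Finset.mul_sum, ← Finset.sum_neg_distrib, ← Finset.sum_add_distrib, ← Finset.sum_add_distrib]
  congr 1
  refine Finset.sum_congr rfl fun k _ => ?_
  have hn1 : (n k : ℝ) - 1 ≠ 0 := by
    have : (2 : ℝ) ≤ n k := by exact_mod_cast hn k
    linarith
  have hl1 := (hl k).ne'
  have hν1 : ν k - 2 ≠ 0 := (sub_pos.2 (hν k)).ne'
  have hp : ν k - 2 + (X0 n X k ^ 2 + b k * (lam n (unvec a) k)⁻¹) ≠ 0 := by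
    have := hpos k
    rw [hTA, hy] at this
    have h' := mul_pos (sub_pos.2 (hν k)) this
    rw [mul_add, mul_one, mul_div_cancel₀ _ hν1] at h'
    exact h'.ne'
  -- The weight `W` is the factor left by differentiating `(ν + n) log (1 + q / (ν - 2))` in `q`.
  have hW : (1 + (X0 n X k ^ 2 + b k * (lam n (unvec a) k)⁻¹) / (ν k - 2))⁻¹ * (ν k - 2)⁻¹ *
      (ν k + n k) = W n ν X k := by
    rw [W, hXk, ← mul_inv, add_mul, one_mul, div_mul_cancel₀ _ hν1, add_assoc]
    field_simp
  rw [S, hXk, ← hW, div_eq_mul_inv (_ + _) (ν k - 2)]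
  -- What remains holds for any value of this inverse.
  generalize (1 + (X0 n X k ^ 2 + b k * (lam n (unvec a) k)⁻¹) * (ν k - 2)⁻¹)⁻¹ = w
  field_simp
  ring

end Likelihood
-- The matrix `Ω_A` as the adjoint of the derivative of the square root.
section Omega
variable {K : ℕ}

theorem kronSum_one_mulVec_vec (R Y : Matrix (Fin K) (Fin K) ℝ) :
    kronSum R 1 *ᵥ Y.vec = (R * Y + Y * Rᵀ).vec := by
  rw [kronSum, Matrix.add_mulVec, kronecker_mulVec_vec, kronecker_mulVec_vec, vec_add]
  simp [add_comm]

theorem isUnit_kronSum_one {R : Matrix (Fin K) (Fin K) ℝ} (hR : R.PosDef) :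
    IsUnit (kronSum R 1) := by
  rw [← Matrix.mulVec_injective_iff_isUnit]
  refine (injective_iff_map_eq_zero (Matrix.mulVecLin (kronSum R 1))).2 fun y hy => ?_
  obtain ⟨Y, rfl⟩ := vec_bijective.surjective y
  have hRt : Rᵀ = R := (by simpa using hR.1 : R.IsSymm).eq
  rw [Matrix.mulVecLin_apply, kronSum_one_mulVec_vec, hRt, vec_eq_zero_iff] at hy
  rw [eq_zero_of_pos_of_mul_add_mul_eq_zero hR.dotProduct_real_pos hy, vec_zero]

/-- Write `G = R Y + Y R`, so that `Ω vec G = vec (R⁻¹ Y)`. Both sides then equal `tr (Y'D) + tr (R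
Y' R⁻¹ D)` by cyclicity of the trace. With `D` the derivative of the root in direction `R D + D R`,
this turns a functional of `D` into a gradient. -/
theorem omega_mulVec_vec_dotProduct {A : Matrix (Fin K) (Fin K) ℝ} (hA : A.PosDef)
    (G D : Matrix (Fin K) (Fin K) ℝ) :
    (Omega A *ᵥ G.vec) ⬝ᵥ (principalSqrt A * D + D * principalSqrt A).vec =
      (Gᵀ * ((principalSqrt A)⁻¹ * D)).trace := by
  have hR := hA.principalSqrt.1
  unfold Omega
  set R := principalSqrt A
  have hRt : Rᵀ = R := (by simpa using hR.1 : R.IsSymm).eq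
  have hRu : IsUnit R.det := hR.isUnit.map Matrix.detMonoidHom
  have hN : IsUnit (kronSum R 1).det := (isUnit_kronSum_one hR).map Matrix.detMonoidHom
  obtain ⟨Y, hY⟩ := vec_bijective.surjective ((kronSum R 1)⁻¹ *ᵥ G.vec)
  have hG : G = R * Y + Y * R := by
    rw [← vec_inj]
    conv_rhs => rw [← hRt]
    nth_rw 1 [hRt]
    rw [← kronSum_one_mulVec_vec, hY, Matrix.mulVec_mulVec, Matrix.mul_nonsing_inv _ hN,
      Matrix.one_mulVec]
  rw [← Matrix.mulVec_mulVec, ← hY, kronecker_mulVec_vec, vec_dotProduct_vec, hG]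
  simp only [transpose_one, Matrix.mul_one, transpose_mul, transpose_add, hRt,
    transpose_nonsing_inv, Matrix.mul_add, Matrix.add_mul, trace_add]
  congr 1
  · rw [Matrix.mul_assoc, Matrix.mul_assoc, Matrix.nonsing_inv_mul_cancel_left _ _ hRu,
      Matrix.mul_nonsing_inv_cancel_left _ _ hRu]
  · rw [← Matrix.mul_assoc, Matrix.trace_mul_comm]
    simp only [Matrix.mul_assoc]

/-- `I ⊗ R⁻¹` and `R ⊕ I` are symmetric and commute. Hence `Ω_A` stands untransposed on both sides
of the information matrix. -/
theorem omega_transpose {A : Matrix (Fin K) (Fin K) ℝ} (hA : A.PosDef) :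
    (Omega A)ᵀ = Omega A := by
  have hR := hA.principalSqrt.1
  unfold Omega
  set R := principalSqrt A
  have hRt : Rᵀ = R := (by simpa using hR.1 : R.IsSymm).eq
  have hRu : IsUnit R.det := hR.isUnit.map Matrix.detMonoidHom
  have hN : IsUnit (kronSum R 1).det := (isUnit_kronSum_one hR).map Matrix.detMonoidHom
  have hNt : (kronSum R 1)ᵀ = kronSum R 1 := by
    simp [kronSum, ← kroneckerMap_transpose, hRt]
  have hc : ((1 : Matrix (Fin K) (Fin K) ℝ) ⊗ₖ R⁻¹) * kronSum R 1 =
      kronSum R 1 * ((1 : Matrix (Fin K) (Fin K) ℝ) ⊗ₖ R⁻¹) := by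
    rw [kronSum, Matrix.mul_add, Matrix.add_mul, ← mul_kronecker_mul, ← mul_kronecker_mul,
      ← mul_kronecker_mul, ← mul_kronecker_mul, Matrix.mul_nonsing_inv _ hRu,
      Matrix.nonsing_inv_mul _ hRu]
    simp
  have hc2 : (kronSum R 1)⁻¹ * ((1 : Matrix (Fin K) (Fin K) ℝ) ⊗ₖ R⁻¹) =
      ((1 : Matrix (Fin K) (Fin K) ℝ) ⊗ₖ R⁻¹) * (kronSum R 1)⁻¹ := by
    calc _ = (kronSum R 1)⁻¹ * (((1 : Matrix (Fin K) (Fin K) ℝ) ⊗ₖ R⁻¹) * kronSum R 1) *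
          (kronSum R 1)⁻¹ := by
          rw [Matrix.mul_assoc, Matrix.mul_assoc, Matrix.mul_nonsing_inv _ hN, Matrix.mul_one]
      _ = _ := by
          rw [hc, ← Matrix.mul_assoc, Matrix.nonsing_inv_mul _ hN, Matrix.one_mul]
  rw [transpose_mul, transpose_nonsing_inv, hNt, ← hc2]
  simp [← kroneckerMap_transpose, transpose_nonsing_inv, hRt]

end Omega

/-! ### The gradient of the log-likelihood. -/

section Score
variable {K : ℕ} {n : Fin K → ℕ} {vp : ∀ k, Matrix (Fin (n k)) (Fin (n k - 1)) ℝ}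

/-- `T` may be nonsymmetric: positivity of its quadratic form already identifies the root. The
formula is therefore available at all `B` near `A`, not only at `A`. -/
theorem principalSqrt_canonC (hn : ∀ k, 2 ≤ n k) (hvp : IsOrthoComplement n vp)
    {A T : Matrix (Fin K) (Fin K) ℝ} (hT : ∀ x ≠ 0, 0 < x ⬝ᵥ T *ᵥ x) (hTA : T * T = A)
    (hl : ∀ k, 0 < lam n A k) :
    principalSqrt (canonC n vp A) = canonM n vp T fun k => √(lam n A k) := by
  refine (isPrincipalSqrt_of_pos
    (canonM_dotProduct_pos hn hvp hT fun k => Real.sqrt_pos.2 (hl k)) ?_).principalSqrt_eq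
  rw [canonM_mul hn hvp, hTA, canonC_eq_canonM]
  congr 1
  ext k
  exact Real.mul_self_sqrt (hl k).le

theorem canonX_canonC (hn : ∀ k, 2 ≤ n k) (hvp : IsOrthoComplement n vp)
    {A : Matrix (Fin K) (Fin K) ℝ} (hA : A.PosDef) (hl : ∀ k, 0 < lam n A k)
    (z : (Σ k, Fin (n k)) → ℝ) :
    canonX n vp (canonC n vp A) z =
      Sum.elim ((principalSqrt A)⁻¹ *ᵥ X0 n ((canonQ n vp)ᵀ *ᵥ z))
        (fun i => (√(lam n A i.1))⁻¹ * ((canonQ n vp)ᵀ *ᵥ z) (Sum.inr i)) := by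
  have hR := hA.principalSqrt
  rw [canonX, principalSqrt_canonC hn hvp hR.1.dotProduct_real_pos hR.2 hl,
    canonM_inv hn hvp (isUnit_det_of_pos hR.1.dotProduct_real_pos)
      (fun k => (Real.sqrt_pos.2 (hl k)).ne'), canonQ_transpose_mulVec_canonM hn hvp]
  rfl

theorem hasGradientAt_logLik (hn : ∀ k, 2 ≤ n k) (hvp : IsOrthoComplement n vp) {ν : Fin K → ℝ}
    (hν : ∀ k, 2 < ν k) {A : Matrix (Fin K) (Fin K) ℝ} (hA : A.PosDef) (hl : ∀ k, 0 < lam n A k)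
    (z : (Σ k, Fin (n k)) → ℝ) {X : (Fin K ⊕ Σ k, Fin (n k - 1)) → ℝ}
    (hX : X = canonX n vp (canonC n vp A) z) :
    HasGradientAt (logLik n ν vp z)
      (WithLp.toLp 2
        (Omega A *ᵥ ((∑ k, (W n ν X k * X0 n X k) • (vecMulVec (Pi.single k 1) (X0 n X)).vec)
            - (1 : Matrix (Fin K) (Fin K) ℝ).vec)
          + (1 / 2 : ℝ) • ((diagElim (Fin K))ᵀ *ᵥ S n ν A X)))
      (WithLp.toLp 2 A.vec) := by
  set a : EuclideanSpace ℝ (Fin K × Fin K) := WithLp.toLp 2 A.vec with ha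
  have haA : unvec a = A := rfl
  have hR := hA.principalSqrt
  have hXe := hX.trans (canonX_canonC hn hvp hA hl z)
  set R := principalSqrt A with hRdef
  have hRpos := hR.1.dotProduct_real_pos
  obtain ⟨T, D, hTc, hTa, hTsq, hD, ⟨L, hL, hL'⟩, hx⟩ :=
    exists_local_sqrt_unvec hRpos (a := a) hR.2.symm
  set y := (canonQ n vp)ᵀ *ᵥ z with hy
  choose L' hx1 hx2 using hx (X0 n y)
  have hX0 : X0 n X = R⁻¹ *ᵥ X0 n y := by rw [hXe]; rfl
  have hXk : ∀ k, Xk n X k ⬝ᵥ Xk n X k = (Xk n y k ⬝ᵥ Xk n y k) * (lam n (unvec a) k)⁻¹ := by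
    intro k
    have : Xk n X k = (√(lam n A k))⁻¹ • Xk n y k := by rw [hXe]; rfl
    rw [this, smul_dotProduct, dotProduct_smul, smul_smul, smul_eq_mul, ← mul_inv,
      Real.mul_self_sqrt (hl k).le, mul_comm, haA]
  obtain ⟨M, hM, hM'⟩ := hasFDerivAt_canonical_logLik hn hν (a := a) hl hTa hL hL' (X0 n y) hx1 hx2
    (fun k => Xk n y k ⬝ᵥ Xk n y k) (fun k => Real.log (Real.Gamma ((ν k + n k) / 2) /
      Real.Gamma (ν k / 2) * ((ν k - 2) * Real.pi) ^ (-(n k : ℝ) / 2)))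
    (fun k => Finset.sum_nonneg fun i _ => mul_self_nonneg _) hX0 hXk
  have hMl : HasFDerivAt (logLik n ν vp z) M a := by
    refine hM.congr_of_eventuallyEq ?_
    have hlc : ∀ᶠ b in nhds a, ∀ k, 0 < lam n (unvec b) k := by
      refine Filter.eventually_all.2 fun k => ?_
      have hc : Continuous fun b : EuclideanSpace ℝ (Fin K × Fin K) => lam n (unvec b) k := by
        simp only [lam, unvec, of_apply]
        fun_prop
      exact hc.continuousAt.eventually (lt_mem_nhds (hl k))
    have hTpos : ∀ᶠ b in nhds a, ∀ x ≠ 0, 0 < x ⬝ᵥ T b *ᵥ x :=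
      hTc.eventually (eventually_forall_dotProduct_pos (hTa.symm ▸ hRpos))
    filter_upwards [hlc, hTpos, hTsq] with b hb1 hb2 hb3
    rw [logLik, principalSqrt_canonC hn hvp hb2 hb3 hb1,
      log_ctDensity_canonM hn hvp hν (isUnit_det_of_pos hb2) hb1]
  rw [hasGradientAt_iff_hasFDerivAt]
  refine hMl.congr_fderiv ?_
  ext h
  rw [hM', InnerProductSpace.toDual_apply_apply, EuclideanSpace.inner_eq_star_dotProduct]
  -- Every direction has Sylvester form, so `omega_mulVec_vec_dotProduct` applies to it.
  have hh : h.ofLp = (R * D h + D h * R).vec := by rw [hD]; rfl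
  have hG : (∑ k, (W n ν X k * X0 n X k) • (vecMulVec (Pi.single k 1) (X0 n X)).vec)
      - (1 : Matrix (Fin K) (Fin K) ℝ).vec =
      ((∑ k, (W n ν X k * X0 n X k) • (vecMulVec (Pi.single k 1) (X0 n X))) - 1).vec := by
    rw [vec_sub, vec_sum]; rfl
  rw [hG, star_trivial, dotProduct_comm, WithLp.ofLp_toLp, add_dotProduct]
  conv_rhs => rw [hh]
  rw [omega_mulVec_vec_dotProduct hA, transpose_sub, transpose_sum, transpose_one, Matrix.sub_mul,
    trace_sub, Matrix.one_mul, Finset.sum_mul, trace_sum, ← hh]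
  congr 1
  · congr 1
    refine Finset.sum_congr rfl fun k _ => ?_
    rw [transpose_smul, Matrix.smul_mul, trace_smul, transpose_vecMulVec, Matrix.mulVec_mulVec,
      vecMulVec_mul, trace_vecMulVec, dotProduct_comm, ← Matrix.dotProduct_mulVec,
      single_one_dotProduct, smul_eq_mul]
  · rw [smul_dotProduct, Matrix.mulVec_transpose, ← Matrix.dotProduct_mulVec, smul_eq_mul]
    congr 1
    refine Finset.sum_congr rfl fun k _ => ?_
    congr 1
    simp [diagElim, Matrix.mulVec, dotProduct]

end Score
-- Integrals of monomials against Gaussian and `t` kernels.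
section Moments

theorem integral_pow_mul_exp_neg_mul_sq (k : ℕ) {b : ℝ} (hb : 0 < b) :
    Integrable (fun x : ℝ => x ^ (2 * k) * Real.exp (-b * x ^ 2)) ∧
    ∫ x : ℝ, x ^ (2 * k) * Real.exp (-b * x ^ 2) =
      Real.Gamma (k + 1 / 2) * b ^ (-((k : ℝ) + 1 / 2)) := by
  have hk : (-1 : ℝ) < ((2 * k : ℕ) : ℝ) := by
    have : (0 : ℝ) ≤ ((2 * k : ℕ) : ℝ) := Nat.cast_nonneg _
    linarith
  constructor
  · simpa only [Real.rpow_natCast] using integrable_rpow_mul_exp_neg_mul_sq hb hk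
  · have h1 : (fun x : ℝ => x ^ (2 * k) * Real.exp (-b * x ^ 2)) =
        fun x => |x| ^ (2 * k) * Real.exp (-b * |x| ^ 2) := by
      ext x
      rw [sq_abs, pow_mul, pow_mul, sq_abs]
    have h2 := integral_rpow_mul_exp_neg_mul_rpow (p := 2) two_pos hk hb
    have h3 : ∀ x : ℝ, x ^ ((2 * k : ℕ) : ℝ) * Real.exp (-b * x ^ (2 : ℝ)) =
        x ^ (2 * k) * Real.exp (-b * x ^ 2) := fun x => by
      rw [Real.rpow_natCast, Real.rpow_two]
    simp only [h3] at h2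
    rw [h1, integral_comp_abs (f := fun x => x ^ (2 * k) * Real.exp (-b * x ^ 2)), h2]
    have h4 : (((2 * k : ℕ) : ℝ) + 1) / 2 = k + 1 / 2 := by push_cast; ring
    rw [neg_div, h4]
    ring

variable {ι : Type*} [Fintype ι]

theorem integral_prod_pow_mul_exp_neg_mul_dotProduct (k : ι → ℕ) {b : ℝ} (hb : 0 < b) :
    Integrable (fun x : ι → ℝ => (∏ j, x j ^ (2 * k j)) * Real.exp (-b * (x ⬝ᵥ x))) ∧
    ∫ x : ι → ℝ, (∏ j, x j ^ (2 * k j)) * Real.exp (-b * (x ⬝ᵥ x)) =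
      (∏ j, Real.Gamma (k j + 1 / 2)) * b ^ (-(∑ j, ((k j : ℝ) + 1 / 2))) := by
  have h : (fun x : ι → ℝ => (∏ j, x j ^ (2 * k j)) * Real.exp (-b * (x ⬝ᵥ x))) =
      fun x => ∏ j, x j ^ (2 * k j) * Real.exp (-b * x j ^ 2) := by
    ext x
    rw [Finset.prod_mul_distrib, ← Real.exp_sum, ← Finset.mul_sum]
    simp only [dotProduct, sq]
  rw [h]
  refine ⟨Integrable.fintype_prod (f := fun j (t : ℝ) => t ^ (2 * k j) * Real.exp (-b * t ^ 2))
    fun j => (integral_pow_mul_exp_neg_mul_sq (k j) hb).1, ?_⟩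
  rw [integral_fintype_prod_volume_eq_prod
    (f := fun j (t : ℝ) => t ^ (2 * k j) * Real.exp (-b * t ^ 2)), ← Finset.sum_neg_distrib,
    Real.rpow_sum_of_pos hb, ← Finset.prod_mul_distrib]
  exact Finset.prod_congr rfl fun j _ => (integral_pow_mul_exp_neg_mul_sq (k j) hb).2

theorem lintegral_rpow_mul_exp_neg_mul_Ioi {q c : ℝ} (hq : 0 < q) (hc : 0 < c) :
    ∫⁻ s in Set.Ioi (0 : ℝ), ENNReal.ofReal (s ^ (q - 1) * Real.exp (-(c * s))) =
      ENNReal.ofReal (c ^ (-q) * Real.Gamma q) := by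
  have hi : IntegrableOn (fun s : ℝ => s ^ (q - 1) * Real.exp (-(c * s))) (Set.Ioi 0) := by
    have := Real.GammaIntegral_convergent hq
    -- A non-integrable function has integral `0` by convention, whereas the known value is
    -- positive.
    by_contra hcon
    have h := Real.integral_rpow_mul_exp_neg_mul_Ioi hq hc
    rw [integral_undef hcon] at h
    have : 0 < (1 / c) ^ q * Real.Gamma q := mul_pos (by positivity) (Real.Gamma_pos_of_pos hq)
    linarith
  rw [← ofReal_integral_eq_lintegral_ofReal hi, Real.integral_rpow_mul_exp_neg_mul_Ioi hq hc]
  · rw [one_div, Real.inv_rpow hc.le, Real.rpow_neg hc.le]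
  · filter_upwards [ae_restrict_mem measurableSet_Ioi] with s hs
    have : (0 : ℝ) < s := hs
    positivity

/-- The `t` kernel is a Gamma mixture of Gaussians: `c^{-q} Γ(q) = ∫ s^{q-1} e^{-cs} ds`. By Tonelli
the `x`-integral comes first; it is Gaussian and contributes `(s/a)^{-t}`, and `Γ(q - t)` is left.
Working with `∫⁻` yields integrability along with the value. -/
theorem integral_prod_pow_mul_rpow (k : ι → ℕ) {a q : ℝ} (ha : 0 < a)
    (hq : ∑ j, ((k j : ℝ) + 1 / 2) < q) :
    Integrable (fun x : ι → ℝ => (∏ j, x j ^ (2 * k j)) * (1 + (x ⬝ᵥ x) / a) ^ (-q)) ∧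
    ∫ x : ι → ℝ, (∏ j, x j ^ (2 * k j)) * (1 + (x ⬝ᵥ x) / a) ^ (-q) =
      (∏ j, Real.Gamma (k j + 1 / 2)) * a ^ (∑ j, ((k j : ℝ) + 1 / 2)) *
        Real.Gamma (q - ∑ j, ((k j : ℝ) + 1 / 2)) / Real.Gamma q := by
  set t := ∑ j, ((k j : ℝ) + 1 / 2) with ht
  have ht0 : 0 ≤ t := Finset.sum_nonneg fun j _ => by positivity
  have hq0 : 0 < q := ht0.trans_lt hq
  have hΓq := Real.Gamma_pos_of_pos hq0
  set p : (ι → ℝ) → ℝ := fun x => ∏ j, x j ^ (2 * k j) with hp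
  have hp0 : ∀ x, 0 ≤ p x := fun x => Finset.prod_nonneg fun j _ => by
    rw [pow_mul]; positivity
  set g := ∏ j, Real.Gamma ((k j : ℝ) + 1 / 2) with hg
  have hg0 : 0 ≤ g := Finset.prod_nonneg fun j _ => (Real.Gamma_pos_of_pos (by positivity)).le
  have hpm : Measurable p := by fun_prop
  have hdm : Measurable fun x : ι → ℝ => x ⬝ᵥ x := by unfold dotProduct; fun_prop
  have hd0 : ∀ x : ι → ℝ, 0 ≤ x ⬝ᵥ x := fun x => Finset.sum_nonneg fun i _ => mul_self_nonneg _
  have hc0 : ∀ x : ι → ℝ, 0 < 1 + (x ⬝ᵥ x) / a := fun x => by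
    have := hd0 x
    positivity
  have key : ∫⁻ x : ι → ℝ, ENNReal.ofReal (p x * (1 + (x ⬝ᵥ x) / a) ^ (-q) * Real.Gamma q) =
      ENNReal.ofReal (g * a ^ t * Real.Gamma (q - t)) := by
    calc _ = ∫⁻ x : ι → ℝ, ∫⁻ s in Set.Ioi (0 : ℝ),
          ENNReal.ofReal (p x * (s ^ (q - 1) * Real.exp (-((1 + (x ⬝ᵥ x) / a) * s)))) := by
          refine lintegral_congr fun x => ?_
          rw [mul_assoc, ENNReal.ofReal_mul (hp0 x), ← lintegral_rpow_mul_exp_neg_mul_Ioi hq0 (hc0 x),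
            ← lintegral_const_mul']
          · simp only [ENNReal.ofReal_mul (hp0 x)]
          · exact ENNReal.ofReal_ne_top
      _ = ∫⁻ s in Set.Ioi (0 : ℝ), ∫⁻ x : ι → ℝ,
          ENNReal.ofReal (p x * (s ^ (q - 1) * Real.exp (-((1 + (x ⬝ᵥ x) / a) * s)))) := by
          refine lintegral_lintegral_swap (Measurable.aemeasurable ?_)
          unfold Function.uncurry
          have h1 : Measurable fun y : (ι → ℝ) × ℝ => p y.1 := hpm.comp measurable_fst
          have h2 : Measurable fun y : (ι → ℝ) × ℝ => y.1 ⬝ᵥ y.1 := hdm.comp measurable_fst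
          fun_prop
      _ = ∫⁻ s in Set.Ioi (0 : ℝ), ENNReal.ofReal (g * a ^ t) *
          ENNReal.ofReal (s ^ ((q - t) - 1) * Real.exp (-(1 * s))) := by
          refine setLIntegral_congr_fun measurableSet_Ioi fun s hs => ?_
          have hs : 0 < s := hs
          obtain ⟨h1, h2⟩ := integral_prod_pow_mul_exp_neg_mul_dotProduct k (div_pos hs ha)
          have h3 : ∀ x : ι → ℝ, p x * (s ^ (q - 1) * Real.exp (-((1 + (x ⬝ᵥ x) / a) * s))) =
              (s ^ (q - 1) * Real.exp (-s)) * (p x * Real.exp (-(s / a) * (x ⬝ᵥ x))) := fun x => by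
            have : -((1 + (x ⬝ᵥ x) / a) * s) = -s + -(s / a) * (x ⬝ᵥ x) := by ring
            rw [this, Real.exp_add]; ring
          have h4 : 0 ≤ s ^ (q - 1) * Real.exp (-s) := by positivity
          simp only [h3, ENNReal.ofReal_mul h4]
          rw [lintegral_const_mul' _ _ ENNReal.ofReal_ne_top,
            ← ofReal_integral_eq_lintegral_ofReal h1
              (Filter.Eventually.of_forall fun x => mul_nonneg (hp0 x) (Real.exp_pos _).le), h2,
            ← ENNReal.ofReal_mul h4, ← ENNReal.ofReal_mul (by positivity), ← hg, ← ht,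
            Real.div_rpow hs.le ha.le, Real.rpow_neg ha.le, one_mul,
            show q - t - 1 = (q - 1) + -t by ring, Real.rpow_add hs]
          congr 1
          field_simp
      _ = _ := by
          rw [lintegral_const_mul' _ _ ENNReal.ofReal_ne_top,
            lintegral_rpow_mul_exp_neg_mul_Ioi (sub_pos.2 hq) one_pos,
            ← ENNReal.ofReal_mul (by positivity), Real.one_rpow, one_mul]
  have hm : Measurable fun x : ι → ℝ => p x * (1 + (x ⬝ᵥ x) / a) ^ (-q) * Real.Gamma q := by
    fun_prop
  have hnn : ∀ x : ι → ℝ, 0 ≤ p x * (1 + (x ⬝ᵥ x) / a) ^ (-q) * Real.Gamma q := fun x => by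
    have := hp0 x
    have := hc0 x
    positivity
  have hval : 0 ≤ g * a ^ t * Real.Gamma (q - t) :=
    mul_nonneg (by positivity) (Real.Gamma_pos_of_pos (sub_pos.2 hq)).le
  have hint : Integrable fun x : ι → ℝ => p x * (1 + (x ⬝ᵥ x) / a) ^ (-q) * Real.Gamma q := by
    refine ⟨hm.aestronglyMeasurable, ?_⟩
    rw [hasFiniteIntegral_iff_ofReal (Filter.Eventually.of_forall hnn), key]
    exact ENNReal.ofReal_lt_top
  have hI := integral_eq_lintegral_of_nonneg_ae (μ := volume) (Filter.Eventually.of_forall hnn)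
    hm.aestronglyMeasurable
  rw [key, ENNReal.toReal_ofReal hval, integral_mul_const] at hI
  refine ⟨?_, ?_⟩
  · have := hint.mul_const (Real.Gamma q)⁻¹
    simpa [mul_assoc, hΓq.ne'] using this
  · rw [eq_div_iff hΓq.ne', hI]

end Moments

/-! ### Moments of the standardized `t` distribution. -/

section StdT
variable {m : ℕ}

theorem measurable_stdTDensity (ν : ℝ) (m : ℕ) : Measurable (stdTDensity ν m) := by
  unfold stdTDensity dotProduct
  fun_prop

theorem integral_stdT {ν : ℝ} (hν : 2 < ν) (f : (Fin m → ℝ) → ℝ) :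
    ∫ x, f x ∂stdT ν m = ∫ x, stdTDensity ν m x * f x := by
  rw [stdT, integral_withDensity_eq_integral_toReal_smul
    (measurable_stdTDensity ν m).ennreal_ofReal
    (Filter.Eventually.of_forall fun x => ENNReal.ofReal_lt_top)]
  refine integral_congr_ae (Filter.Eventually.of_forall fun x => ?_)
  simp [ENNReal.toReal_ofReal (stdTDensity_pos hν m x).le]

theorem integrable_stdT_iff {ν : ℝ} (hν : 2 < ν) (f : (Fin m → ℝ) → ℝ) :
    Integrable f (stdT ν m) ↔ Integrable fun x => stdTDensity ν m x * f x := by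
  rw [stdT, integrable_withDensity_iff_integrable_smul'
    (measurable_stdTDensity ν m).ennreal_ofReal
    (Filter.Eventually.of_forall fun x => ENNReal.ofReal_lt_top)]
  refine integrable_congr (Filter.Eventually.of_forall fun x => ?_)
  simp [ENNReal.toReal_ofReal (stdTDensity_pos hν m x).le]

/-- The reflection in the hyperplane orthogonal to `v - w` carries `v` to `w`. It serves to turn `v`
into a coordinate axis under a spherical density. -/
theorem exists_measurePreserving_dotProduct {v w : Fin m → ℝ} (hv : v ⬝ᵥ v = 1)
    (hw : w ⬝ᵥ w = 1) :
    ∃ e : (Fin m → ℝ) ≃ᵐ (Fin m → ℝ), MeasurePreserving e ∧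
      (∀ x, w ⬝ᵥ e x = v ⬝ᵥ x) ∧ ∀ x, e x ⬝ᵥ e x = x ⬝ᵥ x := by
  have hin : ∀ x y : Fin m → ℝ, inner ℝ (WithLp.toLp 2 x) (WithLp.toLp 2 y) = x ⬝ᵥ y := by
    intro x y
    rw [EuclideanSpace.inner_eq_star_dotProduct, star_trivial, dotProduct_comm]
  set L := (ℝ ∙ (WithLp.toLp 2 v - WithLp.toLp 2 w : EuclideanSpace ℝ (Fin m)))ᗮ.reflection
  have hnorm : ∀ x : Fin m → ℝ, x ⬝ᵥ x = 1 → ‖(WithLp.toLp 2 x : EuclideanSpace ℝ (Fin m))‖ = 1 := by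
    intro x hx
    rw [← pow_eq_one_iff_of_nonneg (norm_nonneg _) two_ne_zero, ← real_inner_self_eq_norm_sq, hin, hx]
  have hL : L (WithLp.toLp 2 v) = WithLp.toLp 2 w :=
    Submodule.reflection_sub ((hnorm v hv).trans (hnorm w hw).symm)
  set e := (MeasurableEquiv.toLp 2 (Fin m → ℝ)).trans
    (L.toMeasurableEquiv.trans (MeasurableEquiv.toLp 2 (Fin m → ℝ)).symm)
  have he : ∀ x, WithLp.toLp 2 (e x) = L (WithLp.toLp 2 x) := fun x => rfl
  refine ⟨e, ?_, fun x => ?_, fun x => ?_⟩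
  · exact (PiLp.volume_preserving_ofLp (Fin m)).comp
      (L.measurePreserving.comp (PiLp.volume_preserving_toLp (Fin m)))
  · rw [← hin, he, ← hL, L.inner_map_map, hin]
  · rw [← hin, he, L.inner_map_map, hin]

/-- Up to a constant, the factor `W^j` changes the exponent `(ν + m)/2` of the density into `(ν +
m)/2 + j`. After rotation a single monomial integral remains, finite under `hij`. -/
theorem stdT_moment {ν : ℝ} (hν : 2 < ν) {v : Fin m → ℝ} (hv : v ⬝ᵥ v = 1) (i j : ℕ)
    (hij : (i : ℝ) < ν / 2 + j) :
    Integrable (fun x => (v ⬝ᵥ x) ^ (2 * i) * ((ν + m) / (ν - 2 + x ⬝ᵥ x)) ^ j) (stdT ν m) ∧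
    ∫ x, (v ⬝ᵥ x) ^ (2 * i) * ((ν + m) / (ν - 2 + x ⬝ᵥ x)) ^ j ∂stdT ν m =
      Real.Gamma (i + 1 / 2) / √Real.pi * (ν - 2) ^ i * ((ν + m) / (ν - 2)) ^ j *
        (Real.Gamma (ν / 2 + j - i) / Real.Gamma (ν / 2)) *
        (Real.Gamma ((ν + m) / 2) / Real.Gamma ((ν + m) / 2 + j)) := by
  have hm : 0 < m := by
    rcases Nat.eq_zero_or_pos m with rfl | h
    · simp [dotProduct] at hv
    · exact h
  have hν0 : 0 < ν - 2 := sub_pos.2 hν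
  set o : Fin m := ⟨0, hm⟩
  have hw : (Pi.single o 1 : Fin m → ℝ) ⬝ᵥ Pi.single o 1 = 1 := by simp
  obtain ⟨e, he, he1, he2⟩ := exists_measurePreserving_dotProduct hv hw
  set k : Fin m → ℕ := Pi.single o i with hk
  have hsum : ∑ j, ((k j : ℝ) + 1 / 2) = i + m / 2 := by
    rw [Finset.sum_add_distrib, ← Nat.cast_sum, hk, Finset.sum_pi_single']
    simp; ring
  have hprod : ∀ x : Fin m → ℝ, ∏ j, x j ^ (2 * k j) = x o ^ (2 * i) := by
    intro x
    rw [Finset.prod_eq_single o]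
    · simp [hk]
    · intro b _ hb; simp [hk, hb]
    · simp
  have hgam : ∏ j, Real.Gamma ((k j : ℝ) + 1 / 2) =
      Real.Gamma (i + 1 / 2) / √Real.pi * Real.pi ^ ((m : ℝ) / 2) := by
    -- The coordinates other than `o` have exponent zero and contribute `Γ(1/2) = √π` each.
    have h1 : ∏ j ∈ Finset.univ.erase o, Real.Gamma ((k j : ℝ) + 1 / 2) = √Real.pi ^ (m - 1) := by
      rw [Finset.prod_congr rfl (g := fun _ => √Real.pi)]
      · simp
      · intro b hb
        have : k b = 0 := by simp [hk, Finset.ne_of_mem_erase hb]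
        rw [this, Nat.cast_zero, zero_add, Real.Gamma_one_half_eq]
    rw [← Finset.mul_prod_erase _ _ (Finset.mem_univ o), h1]
    have h2 : k o = i := by simp [hk]
    have h3 : Real.pi ^ ((m : ℝ) / 2) = √Real.pi ^ (m - 1) * √Real.pi := by
      rw [← pow_succ, Nat.sub_add_cancel hm, Real.sqrt_eq_rpow, ← Real.rpow_natCast,
        ← Real.rpow_mul Real.pi_pos.le]
      congr 1; ring
    have h4 : √Real.pi ≠ 0 := (Real.sqrt_pos.2 Real.pi_pos).ne'
    rw [h2, h3]
    field_simp
  obtain ⟨hi, hI⟩ := integral_prod_pow_mul_rpow k (a := ν - 2) (q := (ν + m) / 2 + j) hν0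
    (by rw [hsum]; linarith)
  simp only [hprod] at hi hI
  rw [hsum, hgam] at hI
  set c := Real.Gamma ((ν + m) / 2) / Real.Gamma (ν / 2) * ((ν - 2) * Real.pi) ^ (-(m : ℝ) / 2) *
    ((ν + m) / (ν - 2)) ^ j with hc
  have hfun : ∀ x, stdTDensity ν m x * ((v ⬝ᵥ x) ^ (2 * i) * ((ν + m) / (ν - 2 + x ⬝ᵥ x)) ^ j) =
      c * ((e x) o ^ (2 * i) * (1 + (e x ⬝ᵥ e x) / (ν - 2)) ^ (-((ν + m) / 2 + j))) := by
    intro x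
    have h1 : (e x) o = v ⬝ᵥ x := by rw [← he1]; simp
    have h0 : 0 ≤ x ⬝ᵥ x := Finset.sum_nonneg fun i _ => mul_self_nonneg _
    have h2 : 0 < 1 + (x ⬝ᵥ x) / (ν - 2) := by positivity
    have h3 : ν - 2 + x ⬝ᵥ x = (ν - 2) * (1 + (x ⬝ᵥ x) / (ν - 2)) := by field_simp
    rw [h1, he2, stdTDensity, hc, h3, neg_add ((ν + m) / 2), Real.rpow_add h2,
      Real.rpow_neg h2.le (j : ℝ), Real.rpow_natCast, neg_div, neg_div, ← div_div,
      div_pow _ (1 + (x ⬝ᵥ x) / (ν - 2))]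
    ring
  rw [integrable_stdT_iff hν, integral_stdT hν]
  simp only [hfun]
  constructor
  · exact (he.integrable_comp_emb e.measurableEmbedding).2 (hi.const_mul c)
  · rw [integral_const_mul, he.integral_comp e.measurableEmbedding
      (fun y => y o ^ (2 * i) * (1 + (y ⬝ᵥ y) / (ν - 2)) ^ (-((ν + m) / 2 + j))), hI, hc,
      Real.mul_rpow hν0.le Real.pi_pos.le, neg_div, Real.rpow_neg hν0.le,
      Real.rpow_neg Real.pi_pos.le, Real.rpow_add hν0, Real.rpow_natCast,
      show (ν + m) / 2 + j - (i + m / 2) = ν / 2 + j - i by ring]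
    have h1 : (ν - 2) ^ ((m : ℝ) / 2) ≠ 0 := by positivity
    have h2 : Real.pi ^ ((m : ℝ) / 2) ≠ 0 := by positivity
    field_simp

end StdT
-- Calculus of integrable functions with known mean.
section HasMean
variable {Ω : Type*} [MeasurableSpace Ω] {μ : Measure Ω} {f g : Ω → ℝ} {c d : ℝ}

/-- `f` is integrable with integral `c`. -/
def HasMean (μ : Measure Ω) (f : Ω → ℝ) (c : ℝ) : Prop := Integrable f μ ∧ ∫ x, f x ∂μ = c

theorem HasMean.add (hf : HasMean μ f c) (hg : HasMean μ g d) :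
    HasMean μ (fun x => f x + g x) (c + d) :=
  ⟨hf.1.add hg.1, by rw [integral_add hf.1 hg.1, hf.2, hg.2]⟩

theorem HasMean.sub (hf : HasMean μ f c) (hg : HasMean μ g d) :
    HasMean μ (fun x => f x - g x) (c - d) :=
  ⟨hf.1.sub hg.1, by rw [integral_sub hf.1 hg.1, hf.2, hg.2]⟩

theorem HasMean.const_mul (hf : HasMean μ f c) (r : ℝ) : HasMean μ (fun x => r * f x) (r * c) :=
  ⟨hf.1.const_mul r, by rw [integral_const_mul, hf.2]⟩

theorem HasMean.sum {ι : Type*} (s : Finset ι) {f : ι → Ω → ℝ} {c : ι → ℝ}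
    (h : ∀ i ∈ s, HasMean μ (f i) (c i)) :
    HasMean μ (fun x => ∑ i ∈ s, f i x) (∑ i ∈ s, c i) :=
  ⟨integrable_finsetSum s fun i hi => (h i hi).1, by
    rw [integral_finsetSum s fun i hi => (h i hi).1]
    exact Finset.sum_congr rfl fun i hi => (h i hi).2⟩

theorem HasMean.congr (hf : HasMean μ f c) (h : ∀ x, g x = f x) (hc : d = c) :
    HasMean μ g d := by
  obtain rfl : g = f := funext h
  rwa [hc]

theorem HasMean.comp_measurePreserving {Ω' : Type*} [MeasurableSpace Ω'] {μ' : Measure Ω'}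
    {T : Ω' → Ω} (hf : HasMean μ f c) (hT : MeasurePreserving T μ' μ) :
    HasMean μ' (fun x => f (T x)) c :=
  ⟨hT.integrable_comp_of_integrable hf.1, by
    rw [← hf.2, ← hT.map_eq, integral_map hT.measurable.aemeasurable]
    rw [hT.map_eq]; exact hf.1.aestronglyMeasurable⟩

theorem HasMean.mulVec_mul_mulVec {ι κ : Type*} [Fintype ι] {F : Ω → ι → ℝ} {N : Matrix ι ι ℝ}
    (h : ∀ i j, HasMean μ (fun x => F x i * F x j) (N i j)) (B : Matrix κ ι ℝ) (p q : κ) :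
    HasMean μ (fun x => (B *ᵥ F x) p * (B *ᵥ F x) q) ((B * N * Bᵀ) p q) := by
  refine (HasMean.sum Finset.univ fun i _ => HasMean.sum Finset.univ fun j _ =>
    (h i j).const_mul (B p i * B q j)).congr (fun x => ?_) ?_
  · simp only [Matrix.mulVec, dotProduct, Finset.sum_mul_sum]
    exact Finset.sum_congr rfl fun i _ => Finset.sum_congr rfl fun j _ => by ring
  · rw [Matrix.mul_assoc, Matrix.mul_apply]
    refine Finset.sum_congr rfl fun i _ => ?_
    rw [Matrix.mul_apply, Finset.mul_sum]
    exact Finset.sum_congr rfl fun j _ => by rw [transpose_apply]; ring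

end HasMean

/-! ### Second moments within one cluster. -/

section Cluster
variable {m : ℕ}

/-- The weight `W` of a cluster. -/
noncomputable def clusterW (ν : ℝ) (x : Fin m → ℝ) : ℝ := (ν + m) / (ν - 2 + x ⬝ᵥ x)

/-- The means of all monomials needed later, by the recursion for `Γ`. The fourth power of `v'x`
comes only with `W²`, so `ν > 2` is enough. -/
theorem hasMean_clusterW {ν : ℝ} (hν : 2 < ν) {v : Fin m → ℝ} (hv : v ⬝ᵥ v = 1) :
    HasMean (stdT ν m) (fun _ => 1) 1 ∧
    HasMean (stdT ν m) (fun x => (v ⬝ᵥ x) ^ 2) 1 ∧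
    HasMean (stdT ν m) (fun x => clusterW ν x) (ν / (ν - 2)) ∧
    HasMean (stdT ν m) (fun x => clusterW ν x ^ 2)
      ((ν + m) / (ν + m + 2) * (ν * (ν + 2) / (ν - 2) ^ 2)) ∧
    HasMean (stdT ν m) (fun x => clusterW ν x * (v ⬝ᵥ x) ^ 2) 1 ∧
    HasMean (stdT ν m) (fun x => clusterW ν x ^ 2 * (v ⬝ᵥ x) ^ 2)
      ((ν + m) / (ν + m + 2) * (ν / (ν - 2))) ∧
    HasMean (stdT ν m) (fun x => clusterW ν x ^ 2 * (v ⬝ᵥ x) ^ 4) (3 * ((ν + m) / (ν + m + 2))) := by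
  have hm0 : (0 : ℝ) ≤ m := Nat.cast_nonneg m
  have hν0 : ν - 2 ≠ 0 := (sub_pos.2 hν).ne'
  have hν1 : ν ≠ 0 := by linarith
  have hN : ν + m ≠ 0 := by linarith
  have hN2 : ν + m + 2 ≠ 0 := by linarith
  have hπ : √Real.pi ≠ 0 := (Real.sqrt_pos.2 Real.pi_pos).ne'
  have g0 : Real.Gamma (((0 : ℕ) : ℝ) + 1 / 2) = √Real.pi := by
    rw [Nat.cast_zero, zero_add, Real.Gamma_one_half_eq]
  have g1 : Real.Gamma (((1 : ℕ) : ℝ) + 1 / 2) = 1 / 2 * √Real.pi := by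
    rw [Nat.cast_one, add_comm, Real.Gamma_add_one (by norm_num), Real.Gamma_one_half_eq]
  have g2 : Real.Gamma (((2 : ℕ) : ℝ) + 1 / 2) = 3 / 4 * √Real.pi := by
    have : ((2 : ℕ) : ℝ) + 1 / 2 = (((1 : ℕ) : ℝ) + 1 / 2) + 1 := by norm_num
    rw [this, Real.Gamma_add_one (by norm_num), g1]
    norm_num; ring
  have a0 : Real.Gamma (ν / 2) ≠ 0 := (Real.Gamma_pos_of_pos (by linarith)).ne'
  have a1 : Real.Gamma (ν / 2 + 1) = ν / 2 * Real.Gamma (ν / 2) :=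
    Real.Gamma_add_one (by linarith)
  have a2 : Real.Gamma (ν / 2 + 2) = (ν / 2 + 1) * (ν / 2 * Real.Gamma (ν / 2)) := by
    rw [← a1, ← Real.Gamma_add_one (by linarith)]
    congr 1; ring
  have am : Real.Gamma (ν / 2) = (ν / 2 - 1) * Real.Gamma (ν / 2 - 1) := by
    rw [← Real.Gamma_add_one (by linarith), sub_add_cancel]
  have am0 : Real.Gamma (ν / 2 - 1) ≠ 0 := (Real.Gamma_pos_of_pos (by linarith)).ne'
  have b0 : Real.Gamma ((ν + m) / 2) ≠ 0 := (Real.Gamma_pos_of_pos (by linarith)).ne'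
  have b1 : Real.Gamma ((ν + m) / 2 + 1) = (ν + m) / 2 * Real.Gamma ((ν + m) / 2) :=
    Real.Gamma_add_one (by linarith)
  have b2 : Real.Gamma ((ν + m) / 2 + 2) =
      ((ν + m) / 2 + 1) * ((ν + m) / 2 * Real.Gamma ((ν + m) / 2)) := by
    rw [← b1, ← Real.Gamma_add_one (by linarith)]
    congr 1; ring
  have M := fun i j hij => stdT_moment (m := m) hν hv i j hij
  have c0 : ν / 2 + ((0 : ℕ) : ℝ) - ((0 : ℕ) : ℝ) = ν / 2 := by norm_num
  have c1 : ν / 2 + ((0 : ℕ) : ℝ) - ((1 : ℕ) : ℝ) = ν / 2 - 1 := by norm_num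
  have c2 : ν / 2 + ((1 : ℕ) : ℝ) - ((0 : ℕ) : ℝ) = ν / 2 + 1 := by norm_num
  have c3 : ν / 2 + ((2 : ℕ) : ℝ) - ((0 : ℕ) : ℝ) = ν / 2 + 2 := by norm_num
  have c4 : ν / 2 + ((1 : ℕ) : ℝ) - ((1 : ℕ) : ℝ) = ν / 2 := by norm_num
  have c5 : ν / 2 + ((2 : ℕ) : ℝ) - ((1 : ℕ) : ℝ) = ν / 2 + 1 := by norm_num; ring
  have c6 : ν / 2 + ((2 : ℕ) : ℝ) - ((2 : ℕ) : ℝ) = ν / 2 := by norm_num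
  have d0 : (ν + m) / 2 + ((0 : ℕ) : ℝ) = (ν + m) / 2 := by norm_num
  have d1 : (ν + m) / 2 + ((1 : ℕ) : ℝ) = (ν + m) / 2 + 1 := by norm_num
  have d2 : (ν + m) / 2 + ((2 : ℕ) : ℝ) = (ν + m) / 2 + 2 := by norm_num
  refine ⟨HasMean.congr (M 0 0 ?_) (fun x => ?_) ?_, HasMean.congr (M 1 0 ?_) (fun x => ?_) ?_,
    HasMean.congr (M 0 1 ?_) (fun x => ?_) ?_, HasMean.congr (M 0 2 ?_) (fun x => ?_) ?_,
    HasMean.congr (M 1 1 ?_) (fun x => ?_) ?_, HasMean.congr (M 1 2 ?_) (fun x => ?_) ?_,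
    HasMean.congr (M 2 2 ?_) (fun x => ?_) ?_⟩
  · push_cast; linarith
  · simp
  · rw [g0, c0, d0]; field_simp
  · push_cast; linarith
  · simp
  · rw [g1, c1, d0, am]
    have : ν / 2 - 1 ≠ 0 := by linarith [sub_pos.2 hν]
    generalize Real.Gamma (ν / 2 - 1) = r at am0
    field_simp
  · push_cast; linarith
  · simp [clusterW]
  · rw [g0, c2, d1, a1, b1]; field_simp
  · push_cast; linarith
  · simp [clusterW]
  · rw [g0, c3, d2, a2, b2]; field_simp
  · push_cast; linarith
  · simp only [clusterW]; ring
  · rw [g1, c4, d1, b1]; field_simp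
  · push_cast; linarith
  · simp only [clusterW]; ring
  · rw [g1, c5, d2, a1, b2]; field_simp
  · push_cast; linarith
  · simp only [clusterW]; ring
  · rw [g2, c6, d2, b2]; field_simp; ring

theorem isProbabilityMeasure_stdT {ν : ℝ} (hν : 2 < ν) (hm : m ≠ 0) :
    IsProbabilityMeasure (stdT ν m) := by
  have h := (hasMean_clusterW hν (unitVec_dotProduct_self hm)).1.2
  rw [integral_const, smul_eq_mul, mul_one, measureReal_def] at h
  exact ⟨(ENNReal.toReal_eq_one_iff _).1 h⟩

variable (ν l : ℝ)

/-- The diagonal term `W X₀² - 1` of a cluster. -/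
noncomputable def clusterG (x : Fin m → ℝ) : ℝ := clusterW ν x * (unitVec m ⬝ᵥ x) ^ 2 - 1

/-- The term `S` of a cluster with eigenvalue `l`. -/
noncomputable def clusterS (x : Fin m → ℝ) : ℝ :=
  1 / l - clusterW ν x * (x ⬝ᵥ x - (unitVec m ⬝ᵥ x) ^ 2) / (l * ((m : ℝ) - 1))

/-- This is `W (ν - 2 + x'x) = ν + m`. It removes `x'x` from `S`, which becomes affine in `W` and `W
(v'x)²`, so that mixed moments with `X_k'X_k` are never needed. -/
theorem clusterW_mul_dotProduct {ν : ℝ} (hν : 2 < ν) (x : Fin m → ℝ) :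
    clusterW ν x * (x ⬝ᵥ x) = (ν + m) - (ν - 2) * clusterW ν x := by
  have h0 : 0 ≤ x ⬝ᵥ x := Finset.sum_nonneg fun i _ => mul_self_nonneg _
  have : ν - 2 + x ⬝ᵥ x ≠ 0 := by linarith
  rw [clusterW]
  field_simp
  ring

theorem clusterS_eq {ν l : ℝ} (hν : 2 < ν) (x : Fin m → ℝ) :
    clusterS ν l x = 1 / l - ((ν + m) - (ν - 2) * clusterW ν x -
      clusterW ν x * (unitVec m ⬝ᵥ x) ^ 2) / (l * ((m : ℝ) - 1)) := by
  rw [clusterS, mul_sub, clusterW_mul_dotProduct hν]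

theorem hasMean_cluster {ν l : ℝ} (hν : 2 < ν) (hm : 2 ≤ m) (hl : l ≠ 0) :
    HasMean (stdT ν m) (clusterG ν) 0 ∧ HasMean (stdT ν m) (clusterS ν l) 0 ∧
    HasMean (stdT ν m) (fun x => clusterG ν x * clusterG ν x)
      (3 * ((ν + m) / (ν + m + 2)) - 1) ∧
    HasMean (stdT ν m) (fun x => clusterS ν l x * clusterG ν x)
      (l⁻¹ * (1 - (ν + m) / (ν + m + 2))) ∧
    HasMean (stdT ν m) (fun x => clusterS ν l x * clusterS ν l x)
      (((ν + m) / (ν + m + 2) - 1) / l ^ 2 +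
        2 * ((ν + m) / (ν + m + 2)) / (l ^ 2 * ((m : ℝ) - 1))) := by
  obtain ⟨h1, hu, hw, hww, hwu, hwwu, hwwuu⟩ :=
    hasMean_clusterW hν (unitVec_dotProduct_self (m := m) (by omega))
  have hm2 : (2 : ℝ) ≤ m := by exact_mod_cast hm
  have hm1 : (m : ℝ) - 1 ≠ 0 := by linarith
  have hν0 : ν - 2 ≠ 0 := (sub_pos.2 hν).ne'
  have hN2 : ν + m + 2 ≠ 0 := by linarith
  -- `S = α + β W + γ W X₀²`
  set α : ℝ := 1 / l - (ν + m) / (l * ((m : ℝ) - 1)) with hα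
  set β : ℝ := (ν - 2) / (l * ((m : ℝ) - 1)) with hβ
  set γ : ℝ := 1 / (l * ((m : ℝ) - 1)) with hγ
  have hS : ∀ x : Fin m → ℝ, clusterS ν l x =
      α + β * clusterW ν x + γ * (clusterW ν x * (unitVec m ⬝ᵥ x) ^ 2) := fun x => by
    rw [clusterS_eq hν, hα, hβ, hγ]; ring
  refine ⟨(hwu.sub h1).congr (fun x => rfl) (by ring),
    (((h1.const_mul α).add (hw.const_mul β)).add (hwu.const_mul γ)).congr
      (fun x => ?_) ?_,
    ((hwwuu.sub (hwu.const_mul 2)).add h1).congr (fun x => ?_) (by ring),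
    ((((h1.const_mul (-α)).add (hw.const_mul (-β))).add (hwu.const_mul (α - γ))).add
      ((hwwu.const_mul β).add (hwwuu.const_mul γ))).congr (fun x => ?_) ?_,
    ((((h1.const_mul (α ^ 2)).add (hw.const_mul (2 * α * β))).add (hwu.const_mul (2 * α * γ))).add
      (((hww.const_mul (β ^ 2)).add (hwwu.const_mul (2 * β * γ))).add
        (hwwuu.const_mul (γ ^ 2)))).congr (fun x => ?_) ?_⟩
  · rw [hS]; ring
  · rw [hα, hβ, hγ]; field_simp; ring
  · rw [clusterG]; ring
  · rw [hS, clusterG]; ring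
  · rw [hα, hβ, hγ]; field_simp; ring
  · rw [hS]; ring
  · rw [hα, hβ, hγ]; field_simp; ring

theorem measurePreserving_neg_stdT : MeasurePreserving (fun x => -x) (stdT ν m) (stdT ν m) := by
  refine ⟨measurable_neg, ?_⟩
  have h : (fun x : Fin m → ℝ => ENNReal.ofReal (stdTDensity ν m x)) =
      (fun x => ENNReal.ofReal (stdTDensity ν m x)) ∘ fun x => -x := by
    ext x; simp [stdTDensity]
  refine Measure.ext fun s hs => ?_
  rw [Measure.map_apply measurable_neg hs, stdT, withDensity_apply _ (measurable_neg hs),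
    withDensity_apply _ hs]
  have := (Measure.measurePreserving_neg (volume : Measure (Fin m → ℝ))).setLIntegral_comp_preimage hs
    (measurable_stdTDensity ν m).ennreal_ofReal
  rw [← this, h]
  rfl

end Cluster
-- Second moments of the standardized score.
section Product
variable {K : ℕ} {n : Fin K → ℕ} {ν : Fin K → ℝ}

/-- Reversal of the sign of cluster `m`. -/
def flipCluster (n : Fin K → ℕ) (m : Fin K) (V : ∀ k, Fin (n k) → ℝ) : ∀ k, Fin (n k) → ℝ :=
  fun k => if k = m then -V k else V k

theorem measurePreserving_flipCluster (h : ∀ k, IsProbabilityMeasure (stdT (ν k) (n k)))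
    (m : Fin K) :
    MeasurePreserving (flipCluster n m) (Measure.pi fun k => stdT (ν k) (n k))
      (Measure.pi fun k => stdT (ν k) (n k)) := by
  refine measurePreserving_pi (f := fun k x => if k = m then -x else x) _ _ fun k => ?_
  by_cases hk : k = m
  · simp only [hk, if_true]
    exact measurePreserving_neg_stdT _
  · simp only [hk, if_false]
    exact MeasurePreserving.id _

/-- The flip preserves the law, so the mean equals its own negative. -/
theorem hasMean_zero_of_flip (h : ∀ k, IsProbabilityMeasure (stdT (ν k) (n k))) (m : Fin K)
    {F : (∀ k, Fin (n k) → ℝ) → ℝ} (hF : Integrable F (Measure.pi fun k => stdT (ν k) (n k)))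
    (hodd : ∀ V, F (flipCluster n m V) = -F V) :
    HasMean (Measure.pi fun k => stdT (ν k) (n k)) F 0 := by
  refine ⟨hF, ?_⟩
  have h1 := (HasMean.comp_measurePreserving (⟨hF, rfl⟩ : HasMean _ F _)
    (measurePreserving_flipCluster h m)).2
  simp only [hodd, integral_neg] at h1
  linarith

theorem hasMean_eval (h : ∀ k, IsProbabilityMeasure (stdT (ν k) (n k))) (k : Fin K)
    {f : (Fin (n k) → ℝ) → ℝ} {c : ℝ} (hf : HasMean (stdT (ν k) (n k)) f c) :
    HasMean (Measure.pi fun k => stdT (ν k) (n k)) (fun V => f (V k)) c :=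
  hf.comp_measurePreserving (measurePreserving_eval _ k)

theorem hasMean_eval_mul_eval (h : ∀ k, IsProbabilityMeasure (stdT (ν k) (n k))) {k l : Fin K}
    (hkl : k ≠ l) {f : (Fin (n k) → ℝ) → ℝ} {g : (Fin (n l) → ℝ) → ℝ} {c d : ℝ}
    (hf : HasMean (stdT (ν k) (n k)) f c) (hg : HasMean (stdT (ν l) (n l)) g d)
    (hfm : Measurable f) (hgm : Measurable g) :
    HasMean (Measure.pi fun k => stdT (ν k) (n k)) (fun V => f (V k) * g (V l)) (c * d) := by
  have hind : IndepFun (fun V : ∀ k, Fin (n k) → ℝ => f (V k)) (fun V => g (V l))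
      (Measure.pi fun k => stdT (ν k) (n k)) :=
    ((iIndepFun_pi (X := fun k (x : Fin (n k) → ℝ) => x)
      fun k => measurable_id.aemeasurable).indepFun hkl).comp hfm hgm
  have h1 := hasMean_eval h k hf
  have h2 := hasMean_eval h l hg
  refine ⟨hind.integrable_mul h1.1 h2.1, ?_⟩
  have := hind.integral_fun_mul_eq_mul_integral h1.1.aestronglyMeasurable h2.1.aestronglyMeasurable
  rw [this, h1.2, h2.2]

@[fun_prop]
theorem measurable_dotProduct_self {m : ℕ} : Measurable fun x : Fin m → ℝ => x ⬝ᵥ x := by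
  unfold dotProduct; fun_prop

@[fun_prop]
theorem measurable_dotProduct_right {m : ℕ} (v : Fin m → ℝ) :
    Measurable fun x : Fin m → ℝ => v ⬝ᵥ x := by
  unfold dotProduct; fun_prop

@[fun_prop]
theorem measurable_clusterW {m : ℕ} (ν : ℝ) : Measurable (clusterW (m := m) ν) := by
  unfold clusterW; fun_prop

@[fun_prop]
theorem measurable_clusterG {m : ℕ} (ν : ℝ) : Measurable (clusterG (m := m) ν) := by
  unfold clusterG; fun_prop

@[fun_prop]
theorem measurable_clusterS {m : ℕ} (ν l : ℝ) : Measurable (clusterS (m := m) ν l) := by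
  unfold clusterS; fun_prop

/-- The standardized score in terms of the independent clusters: the entries of
`∑ W_k X_{0,k} vec (e_k X₀') - vec I`, followed by `S`. -/
noncomputable def stdScore (n : Fin K → ℕ) (ν l : Fin K → ℝ) (V : ∀ k, Fin (n k) → ℝ) :
    (Fin K × Fin K) ⊕ Fin K → ℝ :=
  Sum.elim (fun p => clusterW (ν p.2) (V p.2) * (unitVec (n p.2) ⬝ᵥ V p.2) *
    (unitVec (n p.1) ⬝ᵥ V p.1) - if p.2 = p.1 then 1 else 0)
    (fun k => clusterS (ν k) (l k) (V k))

theorem stdScore_diag (l : Fin K → ℝ) (V : ∀ k, Fin (n k) → ℝ) (i : Fin K) :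
    stdScore n ν l V (Sum.inl (i, i)) = clusterG (ν i) (V i) := by
  simp only [stdScore, Sum.elim_inl, if_true, clusterG]; ring

/-- As `vec` stacks columns, the index `(j, i)` means row `i` and column `j`; the weight belongs to
the row. Such an entry is odd in each of the clusters `i` and `j`, whereas diagonal entries and `S`
are even in every cluster. -/
theorem stdScore_offDiag (l : Fin K → ℝ) (V : ∀ k, Fin (n k) → ℝ) {i j : Fin K} (h : i ≠ j) :
    stdScore n ν l V (Sum.inl (j, i)) =
      clusterW (ν i) (V i) * (unitVec (n i) ⬝ᵥ V i) * (unitVec (n j) ⬝ᵥ V j) := by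
  simp [stdScore, h]

theorem clusterW_neg {m : ℕ} (ν : ℝ) (x : Fin m → ℝ) : clusterW ν (-x) = clusterW ν x := by
  simp [clusterW]

theorem clusterG_neg {m : ℕ} (ν : ℝ) (x : Fin m → ℝ) : clusterG ν (-x) = clusterG ν x := by
  simp [clusterG, clusterW_neg]

theorem clusterS_neg {m : ℕ} (ν l : ℝ) (x : Fin m → ℝ) : clusterS ν l (-x) = clusterS ν l x := by
  simp [clusterS, clusterW_neg]

theorem stdScore_diag_flip (l : Fin K → ℝ) (V : ∀ k, Fin (n k) → ℝ) (i m : Fin K) :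
    stdScore n ν l (flipCluster n m V) (Sum.inl (i, i)) = stdScore n ν l V (Sum.inl (i, i)) := by
  rw [stdScore_diag, stdScore_diag, flipCluster]
  split_ifs
  · rw [clusterG_neg]
  · rfl

theorem stdScore_inr_flip (l : Fin K → ℝ) (V : ∀ k, Fin (n k) → ℝ) (i m : Fin K) :
    stdScore n ν l (flipCluster n m V) (Sum.inr i) = stdScore n ν l V (Sum.inr i) := by
  simp only [stdScore, Sum.elim_inr, flipCluster]
  split_ifs
  · rw [clusterS_neg]
  · rfl

theorem stdScore_flip_of_ne (l : Fin K → ℝ) (V : ∀ k, Fin (n k) → ℝ) {i j m : Fin K}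
    (hi : i ≠ m) (hj : j ≠ m) :
    stdScore n ν l (flipCluster n m V) (Sum.inl (j, i)) = stdScore n ν l V (Sum.inl (j, i)) := by
  simp [stdScore, flipCluster, hi, hj]

theorem stdScore_flip_row (l : Fin K → ℝ) (V : ∀ k, Fin (n k) → ℝ) {i j : Fin K} (h : i ≠ j) :
    stdScore n ν l (flipCluster n i V) (Sum.inl (j, i)) = -stdScore n ν l V (Sum.inl (j, i)) := by
  rw [stdScore_offDiag _ _ h, stdScore_offDiag _ _ h]
  simp [flipCluster, h.symm, clusterW_neg]

theorem stdScore_flip_col (l : Fin K → ℝ) (V : ∀ k, Fin (n k) → ℝ) {i j : Fin K} (h : i ≠ j) :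
    stdScore n ν l (flipCluster n j V) (Sum.inl (j, i)) = -stdScore n ν l V (Sum.inl (j, i)) := by
  rw [stdScore_offDiag _ _ h, stdScore_offDiag _ _ h]
  simp [flipCluster, h]

theorem measurable_stdScore (l : Fin K → ℝ) (p : (Fin K × Fin K) ⊕ Fin K) :
    Measurable fun V => stdScore n ν l V p := by
  rcases p with p | k
  · simp only [stdScore, Sum.elim_inl]
    have h1 : ∀ k, Measurable fun V : ∀ k, Fin (n k) → ℝ => unitVec (n k) ⬝ᵥ V k :=
      fun k => (measurable_dotProduct_right _).comp (measurable_pi_apply k)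
    have h2 : ∀ k, Measurable fun V : ∀ k, Fin (n k) → ℝ => clusterW (ν k) (V k) :=
      fun k => (measurable_clusterW _).comp (measurable_pi_apply k)
    exact (((h2 _).mul (h1 _)).mul (h1 _)).sub_const _
  · exact (measurable_clusterS _ _).comp (measurable_pi_apply k)

/-- By independence the square factors into the means of `W_i² X_{0,i}²` and `X_{0,j}²`, and the
product with the transposed entry into those of `W_i X_{0,i}²` and `W_j X_{0,j}²`, which are `1`.
The latter is the origin of `K_K`. -/
theorem hasMean_stdScore_offDiag_mul (hn : ∀ k, 2 ≤ n k) (hν : ∀ k, 2 < ν k) (l : Fin K → ℝ)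
    {i j : Fin K} (h : i ≠ j) :
    HasMean (Measure.pi fun k => stdT (ν k) (n k))
      (fun V => stdScore n ν l V (Sum.inl (j, i)) * stdScore n ν l V (Sum.inl (j, i)))
      (psi n ν i) ∧
    HasMean (Measure.pi fun k => stdT (ν k) (n k))
      (fun V => stdScore n ν l V (Sum.inl (j, i)) * stdScore n ν l V (Sum.inl (i, j))) 1 := by
  have hp : ∀ k, IsProbabilityMeasure (stdT (ν k) (n k)) := fun k =>
    isProbabilityMeasure_stdT (hν k) (by have := hn k; omega)
  have hc := fun k => hasMean_clusterW (hν k) (unitVec_dotProduct_self (m := n k)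
    (by have := hn k; omega))
  constructor
  · refine (hasMean_eval_mul_eval hp h (hc i).2.2.2.2.2.1 (hc j).2.1 (by fun_prop)
      (by fun_prop)).congr (fun V => ?_) ?_
    · rw [stdScore_offDiag _ _ h]; ring
    · rw [mul_one, psi, phi]
  · refine (hasMean_eval_mul_eval hp h (hc i).2.2.2.2.1 (hc j).2.2.2.2.1 (by fun_prop)
      (by fun_prop)).congr (fun V => ?_) ?_
    · rw [stdScore_offDiag _ _ h, stdScore_offDiag _ _ h.symm]; ring
    · rw [mul_one]

/-- Square integrability makes every product of two entries integrable, so the odd cases need only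
the sign argument. -/
theorem memLp_stdScore (hn : ∀ k, 2 ≤ n k) (hν : ∀ k, 2 < ν k) {l : Fin K → ℝ}
    (hl : ∀ k, l k ≠ 0) (p : (Fin K × Fin K) ⊕ Fin K) :
    MemLp (fun V => stdScore n ν l V p) 2 (Measure.pi fun k => stdT (ν k) (n k)) := by
  rw [memLp_two_iff_integrable_sq (measurable_stdScore l p).aestronglyMeasurable]
  have hp : ∀ k, IsProbabilityMeasure (stdT (ν k) (n k)) := fun k =>
    isProbabilityMeasure_stdT (hν k) (by have := hn k; omega)
  simp only [sq]
  rcases p with ⟨j, i⟩ | k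
  · by_cases h : i = j
    · subst h
      simp only [stdScore_diag]
      exact (hasMean_eval hp i (hasMean_cluster (hν i) (hn i) (hl i)).2.2.1).1
    · exact (hasMean_stdScore_offDiag_mul hn hν l h).1.1
  · exact (hasMean_eval hp k (hasMean_cluster (hν k) (hn k) (hl k)).2.2.2.2).1

theorem unitJ_apply (k i j : Fin K) : unitJ k i j = if i = k ∧ j = k then 1 else 0 := by
  simp only [unitJ, vecMulVec_apply, Pi.single_apply]
  split_ifs <;> simp_all

theorem mul_commMat_apply (M : Matrix (Fin K × Fin K) (Fin K × Fin K) ℝ) (p q : Fin K × Fin K) :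
    (M * commMat (Fin K)) p q = M p q.swap := by
  simp [Matrix.mul_apply, commMat]

/-- All terms except `I ⊗ J_k` sit at the single position `((k, k), (k, k))`; the two in the bracket
coincide, whence the factor `2`. -/
theorem psi_apply (k : Fin K) (p q : Fin K × Fin K) :
    Psi n ν k p q = if p.2 = k then (if p = q then psi n ν k else 0) +
      (if p.1 = p.2 ∧ q.1 = q.2 ∧ p.1 = q.1 then
        (phi n ν k - psi n ν k) + 2 * (phi n ν k - 1) else 0) else 0 := by
  obtain ⟨a, b⟩ := p
  obtain ⟨c, d⟩ := q
  simp only [Psi, Matrix.add_apply, Matrix.smul_apply, kroneckerMap_apply, smul_eq_mul,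
    vecMulVec_apply, vec, mul_commMat_apply, Prod.swap, unitJ_apply, Matrix.one_apply]
  grind

theorem upsilon_apply (p q : Fin K × Fin K) :
    (commMat (Fin K) + Upsilon n ν) p q =
      (if p.1 = q.2 ∧ p.2 = q.1 then 1 else 0) + (if p = q then psi n ν p.2 else 0) +
      (if p.1 = p.2 ∧ q.1 = q.2 ∧ p.1 = q.1 then
        (phi n ν p.1 - psi n ν p.1) + 2 * (phi n ν p.1 - 1) else 0) := by
  rw [Matrix.add_apply, Upsilon, Matrix.sum_apply]
  simp only [psi_apply, Finset.sum_ite_eq, Finset.mem_univ, if_true]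
  rw [add_assoc]
  congr 1
  · simp [commMat, Prod.ext_iff]
  · grind

theorem theta_apply (A : Matrix (Fin K) (Fin K) ℝ) (k i j : Fin K) :
    Theta n ν A k (j, i) = if i = j ∧ i = k then (lam n A k)⁻¹ * (1 - phi n ν k) else 0 := by
  rw [Theta, Matrix.sum_apply, Finset.sum_eq_single k]
  · simp only [Matrix.smul_apply, vecMulVec_apply, vec, unitJ_apply, smul_eq_mul,
      Pi.single_eq_same, one_mul]
    grind
  · intro m _ hm
    simp [vecMulVec_apply, hm.symm]
  · simp

theorem hasMean_stdScore_mul (hn : ∀ k, 2 ≤ n k) (hν : ∀ k, 2 < ν k)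
    {A : Matrix (Fin K) (Fin K) ℝ} (hl : ∀ k, lam n A k ≠ 0) (p q : (Fin K × Fin K) ⊕ Fin K) :
    HasMean (Measure.pi fun k => stdT (ν k) (n k))
      (fun V => stdScore n ν (lam n A) V p * stdScore n ν (lam n A) V q)
      (fromBlocks (commMat (Fin K) + Upsilon n ν) (Theta n ν A)ᵀ (Theta n ν A) (Xi n ν A) p q) := by
  have hp : ∀ k, IsProbabilityMeasure (stdT (ν k) (n k)) := fun k =>
    isProbabilityMeasure_stdT (hν k) (by have := hn k; omega)
  have hc := fun k => hasMean_cluster (hν k) (hn k) (hl k)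
  have hint : ∀ p q, Integrable (fun V => stdScore n ν (lam n A) V p * stdScore n ν (lam n A) V q)
      (Measure.pi fun k => stdT (ν k) (n k)) := fun p q =>
    (memLp_stdScore hn hν hl p).integrable_mul (memLp_stdScore hn hν hl q)
  have hSG : ∀ k i j, HasMean (Measure.pi fun k => stdT (ν k) (n k))
      (fun V => stdScore n ν (lam n A) V (Sum.inr k) * stdScore n ν (lam n A) V (Sum.inl (j, i)))
      (Theta n ν A k (j, i)) := by
    intro k i j
    rw [theta_apply]
    by_cases hij : i = j
    · subst hij
      by_cases hik : i = k
      · subst hik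
        rw [if_pos ⟨rfl, rfl⟩]
        refine (hasMean_eval hp i (hc i).2.2.2.1).congr (fun V => ?_) rfl
        rw [stdScore_diag]; rfl
      · rw [if_neg fun h => hik h.2]
        refine (hasMean_eval_mul_eval hp (Ne.symm hik) (hc k).2.1 (hc i).1 (by fun_prop)
          (by fun_prop)).congr (fun V => ?_) (by ring)
        rw [stdScore_diag]; rfl
    · rw [if_neg fun h => hij h.1]
      refine hasMean_zero_of_flip hp i (hint _ _) fun V => ?_
      rw [stdScore_inr_flip, stdScore_flip_row _ _ hij, mul_neg]
  rcases p with ⟨j, i⟩ | k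
  · rcases q with ⟨l, k⟩ | k
    · rw [fromBlocks_apply₁₁, upsilon_apply]
      by_cases hij : i = j
      · subst hij
        by_cases hkl : k = l
        · subst hkl
          by_cases hik : i = k
          · subst hik
            refine (hasMean_eval hp i (hc i).2.2.1).congr (fun V => ?_) ?_
            · rw [stdScore_diag]
            -- The three contributions add up to `1 + ψ + (φ - ψ) + 2 (φ - 1) = 3 φ - 1`.
            · simp [phi]; ring
          · refine (hasMean_eval_mul_eval hp hik (hc i).1 (hc k).1 (by fun_prop)
              (by fun_prop)).congr (fun V => ?_) ?_
            · rw [stdScore_diag, stdScore_diag]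
            · simp [hik]
        · refine (hasMean_zero_of_flip hp k (hint _ _) fun V => ?_).congr (fun V => rfl) ?_
          · rw [stdScore_diag_flip, stdScore_flip_row _ _ hkl, mul_neg]
          · grind
      · by_cases hkl : k = l
        · subst hkl
          refine (hasMean_zero_of_flip hp i (hint _ _) fun V => ?_).congr (fun V => rfl) ?_
          · rw [stdScore_diag_flip, stdScore_flip_row _ _ hij, neg_mul]
          · grind
        · by_cases h1 : i = k ∧ j = l
          · obtain ⟨rfl, rfl⟩ := h1
            refine (hasMean_stdScore_offDiag_mul hn hν _ hij).1.congr (fun V => rfl) ?_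
            grind
          · by_cases h2 : i = l ∧ j = k
            · obtain ⟨rfl, rfl⟩ := h2
              refine (hasMean_stdScore_offDiag_mul hn hν _ hij).2.congr (fun V => rfl) ?_
              grind
            · have hz : (0 : ℝ) = (if j = k ∧ i = l then 1 else 0) +
                  (if (j, i) = (l, k) then psi n ν i else 0) +
                  (if j = i ∧ l = k ∧ j = l then
                    (phi n ν j - psi n ν j) + 2 * (phi n ν j - 1) else 0) := by
                grind
              -- The sets `{i, j}` and `{k, l}` now differ, so `i` or `j` is missing from the
              -- second. Flipping that cluster changes the sign of the first factor only.
              by_cases h3 : k ≠ i ∧ l ≠ i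
              · refine (hasMean_zero_of_flip hp i (hint _ _) fun V => ?_).congr (fun V => rfl) hz.symm
                rw [stdScore_flip_row _ _ hij, stdScore_flip_of_ne _ _ h3.1 h3.2, neg_mul]
              · have h4 : k ≠ j ∧ l ≠ j := by grind
                refine (hasMean_zero_of_flip hp j (hint _ _) fun V => ?_).congr (fun V => rfl) hz.symm
                rw [stdScore_flip_col _ _ hij, stdScore_flip_of_ne _ _ h4.1 h4.2, neg_mul]
    · exact (hSG k i j).congr (fun V => mul_comm _ _) rfl
  · rcases q with ⟨j, i⟩ | l
    · exact hSG k i j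
    · rw [fromBlocks_apply₂₂, Xi]
      by_cases hkl : k = l
      · subst hkl
        refine (hasMean_eval hp k (hc k).2.2.2.2).congr (fun V => rfl) ?_
        simp [phi]
      · rw [diagonal_apply_ne _ hkl]
        exact (hasMean_eval_mul_eval hp hkl (hc k).2.1 (hc l).2.1 (by fun_prop)
          (by fun_prop)).congr (fun V => rfl) (by ring)

end Product
-- From the standardized score to the information matrix.
section Information
variable {K : ℕ} {n : Fin K → ℕ} {vp : ∀ k, Matrix (Fin (n k)) (Fin (n k - 1)) ℝ}

theorem HasMean.comp_hasLaw {Ω Ω' : Type*} [MeasurableSpace Ω] [MeasurableSpace Ω']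
    {μ : Measure Ω} {P : Measure Ω'} {Y : Ω' → Ω} {f : Ω → ℝ} {c : ℝ} (hf : HasMean μ f c)
    (hY : HasLaw Y μ P) : HasMean P (fun ω => f (Y ω)) c := by
  refine ⟨Integrable.comp_aemeasurable (by rw [hY.map_eq]; exact hf.1) hY.aemeasurable, ?_⟩
  rw [← hf.2]
  exact hY.integral_comp hf.1.aestronglyMeasurable

/-- Here `X_{0,k} = v'u_k` and `X_k'X_k = |u_k|² - (v'u_k)²`. Thus the bracket and `S` are functions
of the clusters `u_k` of `C^{-1/2} Z`, which are independent with `t` laws. -/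
theorem canonQ_transpose_mulVec_eq_stdScore (hn : ∀ k, 2 ≤ n k) (hvp : IsOrthoComplement n vp)
    (ν : Fin K → ℝ) (A : Matrix (Fin K) (Fin K) ℝ) (u : (Σ k, Fin (n k)) → ℝ)
    {X : (Fin K ⊕ Σ k, Fin (n k - 1)) → ℝ} (hX : X = (canonQ n vp)ᵀ *ᵥ u) :
    Sum.elim ((∑ k, (W n ν X k * X0 n X k) • (vecMulVec (Pi.single k 1) (X0 n X)).vec)
      - (1 : Matrix (Fin K) (Fin K) ℝ).vec) (S n ν A X) =
    stdScore n ν (lam n A) fun k i => u ⟨k, i⟩ := by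
  have h0 : ∀ k, X0 n X k = unitVec (n k) ⬝ᵥ fun i => u ⟨k, i⟩ := fun k => by
    rw [X0, hX, canonQ_transpose_mulVec_inl]
  have hk : ∀ k, Xk n X k ⬝ᵥ Xk n X k = ((fun i => u ⟨k, i⟩) ⬝ᵥ fun i => u ⟨k, i⟩) -
      (unitVec (n k) ⬝ᵥ fun i => u ⟨k, i⟩) ^ 2 := fun k => by
    have : Xk n X k = (vp k)ᵀ *ᵥ fun i => u ⟨k, i⟩ := by
      ext j
      rw [Xk, hX, canonQ_transpose_mulVec_inr]
    rw [this, hvp.dotProduct_self_eq hn k, add_sub_cancel_left]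
  have hW : ∀ k, W n ν X k = clusterW (ν k) fun i => u ⟨k, i⟩ := fun k => by
    rw [W, hk, h0, add_assoc, add_sub_cancel, clusterW]
  ext (⟨j, i⟩ | k)
  · simp only [Sum.elim_inl, Pi.sub_apply, Finset.sum_apply, Pi.smul_apply, vec, vecMulVec_apply,
      smul_eq_mul, stdScore, Matrix.one_apply]
    rw [Finset.sum_eq_single i]
    · rw [hW, h0, h0]; simp
    · intro m _ hm; simp [hm.symm]
    · simp
  · simp only [Sum.elim_inr, stdScore, S, clusterS]
    rw [hW, hk]

theorem hasLaw_standardize {ν : Fin K → ℝ} {M : Matrix (Σ k, Fin (n k)) (Σ k, Fin (n k)) ℝ}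
    (hM : IsUnit M.det) :
    HasLaw (fun z k i => (M⁻¹ *ᵥ z) ⟨k, i⟩) (Measure.pi fun k => stdT (ν k) (n k))
      (ctLaw n ν M) := by
  have hm1 : Measurable fun (z : (Σ k, Fin (n k)) → ℝ) k i => (M⁻¹ *ᵥ z) ⟨k, i⟩ := by
    unfold Matrix.mulVec dotProduct; fun_prop
  have hm2 : Measurable fun (v : ∀ k, Fin (n k) → ℝ) => M *ᵥ fun i : Σ k, Fin (n k) => v i.1 i.2 := by
    unfold Matrix.mulVec dotProduct; fun_prop
  refine ⟨hm1.aemeasurable, ?_⟩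
  rw [ctLaw, Measure.map_map hm1 hm2]
  convert Measure.map_id
  ext v k i
  simp [Matrix.mulVec_mulVec, Matrix.nonsing_inv_mul _ hM]

theorem fromCols_mul_fromBlocks_mul_transpose {ι κ : Type*} [Fintype ι] [Fintype κ]
    (O M : Matrix ι ι ℝ) (E Θ : Matrix κ ι ℝ) (Ξ : Matrix κ κ ℝ) (hO : Oᵀ = O) (r : ℝ) :
    fromCols O (r • Eᵀ) * fromBlocks M Θᵀ Θ Ξ * (fromCols O (r • Eᵀ))ᵀ =
      O * M * O + (r * r) • (Eᵀ * Ξ * E) + r • (Eᵀ * Θ * O) + r • (O * Θᵀ * E) := by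
  rw [fromCols_mul_fromBlocks, transpose_fromCols, fromCols_mul_fromRows, hO]
  simp only [transpose_smul, transpose_transpose, Matrix.add_mul, Matrix.smul_mul, Matrix.mul_smul,
    smul_add, smul_smul]
  abel

end Information
end ClusterT

theorem theorem4 {K : ℕ} (n : Fin K → ℕ) (hn : ∀ k, 2 ≤ n k)
    (ν : Fin K → ℝ) (hν : ∀ k, 2 < ν k)
    (ρ : Matrix (Fin K) (Fin K) ℝ) (hC : (ClusterT.blockCorr n ρ).PosDef)
    (vp : ∀ k, Matrix (Fin (n k)) (Fin (n k - 1)) ℝ) (hvp : ClusterT.IsOrthoComplement n vp)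
    {Ω : Type*} [MeasurableSpace Ω] (P : Measure Ω) [IsProbabilityMeasure P]
    (Z : Ω → (Σ k, Fin (n k)) → ℝ)
    (hZ : HasLaw Z
      (ClusterT.ctLaw n ν (ClusterT.principalSqrt (ClusterT.blockCorr n ρ))) P) :
    let C := ClusterT.blockCorr n ρ
    let A := ClusterT.canonA n ρ
    let ΩA := ClusterT.Omega A
    let Ed := ClusterT.diagElim (Fin K)
    let Θ := ClusterT.Theta n ν A
    (∀ z : (Σ k, Fin (n k)) → ℝ,
      let X := ClusterT.canonX n vp C z
      let X0 := ClusterT.X0 n X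
      HasGradientAt (ClusterT.logLik n ν vp z)
        (WithLp.toLp 2
          (ΩA *ᵥ ((∑ k, (ClusterT.W n ν X k * X0 k) • (vecMulVec (Pi.single k 1) X0).vec)
              - (1 : Matrix (Fin K) (Fin K) ℝ).vec)
            + (1 / 2 : ℝ) • (Edᵀ *ᵥ ClusterT.S n ν A X)))
        (WithLp.toLp 2 A.vec)) ∧
    (∀ p q, Integrable
      (fun ω => ClusterT.score n ν vp A (Z ω) p * ClusterT.score n ν vp A (Z ω) q) P) ∧
    (Matrix.of fun p q =>
        ∫ ω, ClusterT.score n ν vp A (Z ω) p * ClusterT.score n ν vp A (Z ω) q ∂P) =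
      ΩA * (ClusterT.commMat (Fin K) + ClusterT.Upsilon n ν) * ΩA
        + (1 / 4 : ℝ) • (Edᵀ * ClusterT.Xi n ν A * Ed)
        + (1 / 2 : ℝ) • (Edᵀ * Θ * ΩA)
        + (1 / 2 : ℝ) • (ΩA * Θᵀ * Ed) := by
  intro C A ΩA Ed Θ
  have hCA : C = ClusterT.canonC n vp A := ClusterT.blockCorr_eq_canonC hn hvp ρ
  obtain ⟨hA, hl⟩ : A.PosDef ∧ ∀ k, 0 < ClusterT.lam n A k :=
    ClusterT.posDef_of_canonM hn hvp (by rw [← ClusterT.canonC_eq_canonM, ← hCA]; exact hC)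
  have hgrad := fun z => ClusterT.hasGradientAt_logLik hn hvp hν hA hl z
    (X := ClusterT.canonX n vp C z) (by rw [hCA])
  have hM : IsUnit (ClusterT.principalSqrt C).det :=
    ClusterT.isUnit_det_of_pos hC.principalSqrt.1.dotProduct_real_pos
  -- The score is `B` times the standardized score, so the information is `B N B'` with `N` the
  -- block matrix of second moments; the four blocks of `N` give the four terms.
  set B : Matrix (Fin K × Fin K) ((Fin K × Fin K) ⊕ Fin K) ℝ :=
    fromCols ΩA ((1 / 2 : ℝ) • Edᵀ) with hB
  set Y : ((Σ k, Fin (n k)) → ℝ) → ∀ k, Fin (n k) → ℝ :=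
    fun z k i => ((ClusterT.principalSqrt C)⁻¹ *ᵥ z) ⟨k, i⟩ with hY
  have hscore : ∀ z p, ClusterT.score n ν vp A z p =
      (B *ᵥ ClusterT.stdScore n ν (ClusterT.lam n A) (Y z)) p := by
    intro z p
    rw [ClusterT.score, (hgrad z).gradient, hB, hY,
      ← ClusterT.canonQ_transpose_mulVec_eq_stdScore hn hvp ν A _ rfl, fromCols_mulVec_sumElim,
      Matrix.smul_mulVec]
    rfl
  have hlaw : HasLaw (fun ω => Y (Z ω)) (Measure.pi fun k => ClusterT.stdT (ν k) (n k)) P :=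
    (ClusterT.hasLaw_standardize hM).comp hZ
  have hmean : ∀ p q, ClusterT.HasMean P
      (fun ω => ClusterT.score n ν vp A (Z ω) p * ClusterT.score n ν vp A (Z ω) q)
      ((ΩA * (ClusterT.commMat (Fin K) + ClusterT.Upsilon n ν) * ΩA
        + (1 / 4 : ℝ) • (Edᵀ * ClusterT.Xi n ν A * Ed)
        + (1 / 2 : ℝ) • (Edᵀ * Θ * ΩA)
        + (1 / 2 : ℝ) • (ΩA * Θᵀ * Ed)) p q) := by
    intro p q
    refine ((ClusterT.HasMean.mulVec_mul_mulVec
      (ClusterT.hasMean_stdScore_mul hn hν fun k => (hl k).ne') B p q).comp_hasLaw hlaw).congr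
      (fun ω => by rw [hscore, hscore]) ?_
    rw [hB, ClusterT.fromCols_mul_fromBlocks_mul_transpose _ _ _ _ _ (ClusterT.omega_transpose hA)]
    norm_num
    rfl
  exact ⟨hgrad, fun p q => (hmean p q).1, by ext p q; exact (hmean p q).2⟩
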